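/- Let $I$ be a nonempty finite set. A forest on $I$ is a set of leaf-labelled rooted (non-planar) binary trees whose leaves are, all together, bijectively labelled by $I$; $V(F)$ denotes its set of inner vertices. An inner-oriented forest $o\otimes F$ is a forest $F$ with a global orientation $o$ (a generator of the top exterior power of $\mathbb{Z}(V(F)\sqcup\{R\})$, $R$ an auxiliary element) and, at each inner vertex, a local orientation (a generator of the top exterior power on its three half-edges). Let $\operatorname{Bess}(I)$ be the $\mathbb{Q}$-vector space spanned by inner-oriented forests on $I$, where reversing a global or a local orientation changes the sign. It is graded by the number of inner vertices. For disjoint nonempty finite sets $I,J$, composition with the two generators of the Bessel operad gives bilinear maps $E,\Omega:\operatorname{Bess}(I)\times\operatorname{Bess}(J)\to\operatorname{Bess}(I\sqcup J)$: if $o_1=R_1\wedge v_1\wedge\dots\wedge v_m$ and $o_2=R_2\wedge w_1\wedge\dots\wedge w_n$, then $$E(o_1\otimes F_1,o_2\otimes F_2)=(R\wedge v_1\wedge\dots\wedge v_m\wedge w_1\wedge\dots\wedge w_n)\otimes(F_1\sqcup F_2),$$ $$\Omega(o_1\otimes F_1,o_2\otimes F_2)=\sum_{T_1,T_2}(R\wedge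 v\wedge v_1\wedge\dots\wedge v_m\wedge w_1\wedge\dots\wedge w_n)\otimes F_{T_1,T_2},$$ where $T_1$ (resp. $T_2$) runs over the trees of $F_1$ (resp. $F_2$), the forest $F_{T_1,T_2}$ is obtained from $F_1\sqcup F_2$ by joining the roots of $T_1$ and $T_2$ to a new inner vertex $v$, with local orientation $\mathrm{root}\wedge T_1\wedge T_2$ at $v$, and the other local orientations are unchanged. There is exactly one family of linear maps $\Delta:\operatorname{Bess}(I)\to\operatorname{Bess}(I)\otimes\operatorname{Bess}(I)$ (the coproduct of the Bessel operad) such that $\Delta(u)=u\otimes u$ for the one-leaf tree $u$ with orientation $R$, and, for all $x,y$, $$\Delta(E(x,y))=(E\otimes E)(\Delta x,\Delta y),\qquad \Delta(\Omega(x,y))=(E\otimes\Omega+\Omega\otimes E)(\Delta x,\Delta y),$$ where, by the Koszul sign rule, $(\mu\otimes\nu)(x_1\otimes x_2,y_1\otimes y_2)=(-1)^{|\nu|(|x_1|+|y_1|)+|x_2||y_1|}\mu(x_1,y_1)\otimes\nu(x_2,y_2)$, with $|E|=0$ and $|\Omega|=1$. For each nonempty finite set $I$ the following holds. The degree zero component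 of $\operatorname{Bess}(I)$ is one-dimensional, spanned by the forest $g_I$ with no inner vertex (with orientation $R$). Identify this component with $\mathbb{Q}$ by $g_I\mapsto 1$; let $\varepsilon:\operatorname{Bess}(I)\to\mathbb{Q}$ be the projection onto it and $\eta:\mathbb{Q}\to\operatorname{Bess}(I)$ its inclusion. Then $\varepsilon$ is a counit, that is $(\varepsilon\otimes\mathrm{id})\Delta=\mathrm{id}=(\mathrm{id}\otimes\varepsilon)\Delta$; the map $\eta$ is an augmentation, that is $\Delta(\eta(1))=\eta(1)\otimes\eta(1)$ and $\varepsilon\circ\eta=\mathrm{id}$; and $g_I$ is grouplike, that is $\Delta(g_I)=g_I\otimes g_I$ and $\varepsilon(g_I)=1$. -/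

import Mathlib

open scoped TensorProduct

namespace Bessel

/-! ### Forests of leaf-labelled rooted binary trees

A forest with set of leaves `S` is recorded by the set of its inner vertices. An inner vertex is
recorded by the unordered pair `s(A, B)`, where `A` and `B` are the sets of leaves lying above its
two incoming edges. A tree or a subtree is thus identified by its set of leaves. -/

section Forests

variable {α : Type*} [DecidableEq α]

/-- `IsTree S V`: the set `V` is the set of inner vertices of a rooted binary tree whose leaves are
bijectively labelled by `S`. -/
inductive IsTree : Finset α → Finset (Sym2 (Finset α)) → Prop
  | leaf (a : α) : IsTree {a} ∅
  | graft {S T : Finset α} {V W : Finset (Sym2 (Finset α))} :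
      IsTree S V → IsTree T W → Disjoint S T → IsTree (S ∪ T) (insert s(S, T) (V ∪ W))

/-- `IsForest S V`: the set `V` is the set of inner vertices of a (nonempty) set of rooted binary
trees whose leaves are, all together, bijectively labelled by `S`. -/
inductive IsForest : Finset α → Finset (Sym2 (Finset α)) → Prop
  | tree {S : Finset α} {V : Finset (Sym2 (Finset α))} : IsTree S V → IsForest S V
  | union {S T : Finset α} {V W : Finset (Sym2 (Finset α))} :
      IsForest S V → IsForest T W → Disjoint S T → IsForest (S ∪ T) (V ∪ W)

/-- The set of leaves lying above an inner vertex. -/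
def vertexLeaves : Sym2 (Finset α) → Finset α :=
  Sym2.lift ⟨fun A B => A ∪ B, fun A B => Finset.union_comm A B⟩

/-- The trees of the forest on `S` with set of inner vertices `V`, each given by its set of leaves:
the leaves and inner vertices which are not directly above another inner vertex. -/
def roots (S : Finset α) (V : Finset (Sym2 (Finset α))) : Finset (Finset α) :=
  (S.image (fun a => {a}) ∪ V.image vertexLeaves).filter (fun r => ∀ v ∈ V, r ∉ v)

@[simp] theorem vertexLeaves_mk (A B : Finset α) : vertexLeaves s(A, B) = A ∪ B := rfl

theorem IsTree.nonempty {S : Finset α} {V : Finset (Sym2 (Finset α))} (h : IsTree S V) :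
    S.Nonempty := by
  induction h with
  | leaf a => simp
  | graft _ _ _ h₁ _ => exact h₁.mono Finset.subset_union_left

theorem IsForest.nonempty {S : Finset α} {V : Finset (Sym2 (Finset α))} (h : IsForest S V) :
    S.Nonempty := by
  induction h with
  | tree h => exact h.nonempty
  | union _ _ _ h₁ _ => exact h₁.mono Finset.subset_union_left

theorem IsTree.vertex {S : Finset α} {V : Finset (Sym2 (Finset α))} (h : IsTree S V) :
    ∀ v ∈ V, vertexLeaves v ⊆ S ∧ ∀ r ∈ v, r.Nonempty ∧ r ⊂ vertexLeaves v := by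
  induction h with
  | leaf a => simp
  | @graft S T V W hV hW hd h₁ h₂ =>
    intro v hv
    simp only [Finset.mem_insert, Finset.mem_union] at hv
    rcases hv with rfl | hv | hv
    · refine ⟨by simp, ?_⟩
      intro r hr
      rcases Sym2.mem_iff.1 hr with rfl | rfl
      · refine ⟨hV.nonempty, ?_⟩
        obtain ⟨x, hx⟩ := hW.nonempty
        exact Finset.ssubset_iff_subset_ne.2 ⟨Finset.subset_union_left, fun h =>
          Finset.disjoint_right.1 hd hx (h ▸ Finset.mem_union_right _ hx)⟩
      · refine ⟨hW.nonempty, ?_⟩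
        obtain ⟨x, hx⟩ := hV.nonempty
        exact Finset.ssubset_iff_subset_ne.2 ⟨Finset.subset_union_right, fun h =>
          Finset.disjoint_left.1 hd hx (h ▸ Finset.mem_union_left _ hx)⟩
    · exact ⟨(h₁ v hv).1.trans Finset.subset_union_left, (h₁ v hv).2⟩
    · exact ⟨(h₂ v hv).1.trans Finset.subset_union_right, (h₂ v hv).2⟩

theorem IsForest.vertex {S : Finset α} {V : Finset (Sym2 (Finset α))} (h : IsForest S V) :
    ∀ v ∈ V, vertexLeaves v ⊆ S ∧ ∀ r ∈ v, r.Nonempty ∧ r ⊂ vertexLeaves v := by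
  induction h with
  | tree h => exact h.vertex
  | @union S T V W hV hW hd h₁ h₂ =>
    intro v hv
    rcases Finset.mem_union.1 hv with hv | hv
    · exact ⟨(h₁ v hv).1.trans Finset.subset_union_left, (h₁ v hv).2⟩
    · exact ⟨(h₂ v hv).1.trans Finset.subset_union_right, (h₂ v hv).2⟩

theorem IsForest.vertexLeaves_nonempty {S : Finset α} {V : Finset (Sym2 (Finset α))}
    (h : IsForest S V) {v : Sym2 (Finset α)} (hv : v ∈ V) : (vertexLeaves v).Nonempty := by
  induction v with
  | _ A B => exact ((h.vertex _ hv).2 A (Sym2.mem_mk_left _ _)).1.mono Finset.subset_union_left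

theorem IsForest.of_mem_roots {S : Finset α} {V : Finset (Sym2 (Finset α))} (h : IsForest S V)
    {r : Finset α} (hr : r ∈ roots S V) : r.Nonempty ∧ r ⊆ S := by
  simp only [roots, Finset.mem_filter, Finset.mem_union, Finset.mem_image] at hr
  obtain ⟨⟨a, ha, rfl⟩ | ⟨v, hv, rfl⟩, -⟩ := hr
  · simpa using ha
  · exact ⟨h.vertexLeaves_nonempty hv, (h.vertex v hv).1⟩

theorem IsTree.eq_of_mem_roots {S : Finset α} {V : Finset (Sym2 (Finset α))} (h : IsTree S V)
    {r : Finset α} (hr : r ∈ roots S V) : r = S := by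
  induction h generalizing r with
  | leaf a => simpa [roots] using hr
  | @graft S T V W hV hW hd h₁ h₂ =>
    simp only [roots, Finset.mem_filter, Finset.mem_union, Finset.mem_image,
      Finset.mem_insert] at hr
    obtain ⟨hr, hn⟩ := hr
    have hS : r ≠ S := fun e => hn _ (Or.inl rfl) (e ▸ Sym2.mem_mk_left _ _)
    have hT : r ≠ T := fun e => hn _ (Or.inl rfl) (e ▸ Sym2.mem_mk_right _ _)
    have key₁ : r ∈ S.image (fun a => {a}) ∪ V.image vertexLeaves → False := fun h =>
      hS (h₁ (Finset.mem_filter.2 ⟨h, fun v hv => hn v (Or.inr (Or.inl hv))⟩))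
    have key₂ : r ∈ T.image (fun a => {a}) ∪ W.image vertexLeaves → False := fun h =>
      hT (h₂ (Finset.mem_filter.2 ⟨h, fun v hv => hn v (Or.inr (Or.inr hv))⟩))
    simp only [Finset.mem_union, Finset.mem_image] at key₁ key₂
    rcases hr with ⟨a, ha | ha, e⟩ | ⟨v, rfl | hv | hv, e⟩
    · exact (key₁ (Or.inl ⟨a, ha, e⟩)).elim
    · exact (key₂ (Or.inl ⟨a, ha, e⟩)).elim
    · exact e.symm
    · exact (key₁ (Or.inr ⟨v, hv, e⟩)).elim
    · exact (key₂ (Or.inr ⟨v, hv, e⟩)).elim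

/-- A tree can be removed from a forest. -/
theorem IsForest.split {S : Finset α} {V : Finset (Sym2 (Finset α))} (h : IsForest S V)
    {r : Finset α} (hr : r ∈ roots S V) :
    (r = S ∧ IsTree S V) ∨ ∃ S' V₁ V₂, Disjoint r S' ∧ S = r ∪ S' ∧ V = V₁ ∪ V₂ ∧
      IsTree r V₁ ∧ IsForest S' V₂ := by
  induction h generalizing r with
  | tree h => exact Or.inl ⟨h.eq_of_mem_roots hr, h⟩
  | @union S T V W hV hW hd h₁ h₂ =>
    right
    simp only [roots, Finset.mem_filter, Finset.mem_union, Finset.mem_image] at hr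
    obtain ⟨hr, hn⟩ := hr
    have hr' : r ∈ roots S V ∨ r ∈ roots T W := by
      simp only [roots, Finset.mem_filter, Finset.mem_union, Finset.mem_image]
      rcases hr with ⟨a, ha | ha, e⟩ | ⟨v, hv | hv, e⟩
      · exact Or.inl ⟨Or.inl ⟨a, ha, e⟩, fun v hv => hn v (Or.inl hv)⟩
      · exact Or.inr ⟨Or.inl ⟨a, ha, e⟩, fun v hv => hn v (Or.inr hv)⟩
      · exact Or.inl ⟨Or.inr ⟨v, hv, e⟩, fun v hv => hn v (Or.inl hv)⟩
      · exact Or.inr ⟨Or.inr ⟨v, hv, e⟩, fun v hv => hn v (Or.inr hv)⟩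
    rcases hr' with hr' | hr'
    · rcases h₁ hr' with ⟨rfl, ht⟩ | ⟨S', V₁, V₂, hd', rfl, rfl, ht, hf⟩
      · exact ⟨T, V, W, hd, rfl, rfl, ht, hW⟩
      · rw [Finset.disjoint_union_left] at hd
        exact ⟨S' ∪ T, V₁, V₂ ∪ W, Finset.disjoint_union_right.2 ⟨hd', hd.1⟩,
          Finset.union_assoc _ _ _, Finset.union_assoc _ _ _, ht, hf.union hW hd.2⟩
    · rcases h₂ hr' with ⟨rfl, ht⟩ | ⟨T', W₁, W₂, hd', rfl, rfl, ht, hf⟩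
      · exact ⟨S, W, V, hd.symm, Finset.union_comm _ _, Finset.union_comm _ _, ht, hV⟩
      · rw [Finset.disjoint_union_right] at hd
        exact ⟨S ∪ T', W₁, V ∪ W₂, Finset.disjoint_union_right.2 ⟨hd.1.symm, hd'⟩,
          Finset.union_left_comm _ _ _, Finset.union_left_comm _ _ _, ht, hV.union hf hd.2⟩

/-- Joining a tree of a first forest and a tree of a second forest by a new inner vertex gives a
forest. -/
theorem IsForest.graft {S T : Finset α} {V W : Finset (Sym2 (Finset α))} (hV : IsForest S V)
    (hW : IsForest T W) (hd : Disjoint S T) {r s : Finset α} (hr : r ∈ roots S V)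
    (hs : s ∈ roots T W) : IsForest (S ∪ T) (insert s(r, s) (V ∪ W)) := by
  rcases hV.split hr with ⟨rfl, ht⟩ | ⟨S', V₁, V₂, hS, rfl, rfl, ht, hf⟩ <;>
    rcases hW.split hs with ⟨rfl, ht'⟩ | ⟨T', W₁, W₂, hT, rfl, rfl, ht', hf'⟩
  · exact .tree (.graft ht ht' hd)
  · simp only [Finset.disjoint_union_right] at hd
    have := (IsForest.tree (.graft ht ht' hd.1)).union hf'
      (Finset.disjoint_union_left.2 ⟨hd.2, hT⟩)
    convert this using 1 <;> ext <;> simp only [Finset.mem_union, Finset.mem_insert] <;> tauto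
  · simp only [Finset.disjoint_union_left] at hd
    have := (IsForest.tree (.graft ht ht' hd.1)).union hf
      (Finset.disjoint_union_left.2 ⟨hS, hd.2.symm⟩)
    convert this using 1 <;> ext <;> simp only [Finset.mem_union, Finset.mem_insert] <;> tauto
  · have h₁ := Finset.disjoint_union_left.1 hd
    have h₂ := Finset.disjoint_union_right.1 h₁.1
    have h₃ := Finset.disjoint_union_right.1 h₁.2
    have := (IsForest.tree (.graft ht ht' h₂.1)).union (hf.union hf' h₃.2)
      (Finset.disjoint_union_left.2 ⟨Finset.disjoint_union_right.2 ⟨hS, h₂.2⟩,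
        Finset.disjoint_union_right.2 ⟨h₃.1.symm, hT⟩⟩)
    convert this using 1 <;> ext <;> simp only [Finset.mem_union, Finset.mem_insert] <;> tauto

theorem IsForest.noVertex {S : Finset α} (hS : S.Nonempty) : IsForest S ∅ := by
  induction hS using Finset.Nonempty.cons_induction with
  | singleton a => exact .tree (.leaf a)
  | cons a s ha hs ih =>
    have := (IsForest.tree (.leaf a)).union ih (Finset.disjoint_singleton_left.2 ha)
    rw [Finset.cons_eq_insert, Finset.insert_eq]
    rwa [Finset.union_empty] at this

end Forests

/-! ### Inner-oriented forests

A global orientation of a forest `F` is an orientation of `V(F) ⊔ {R}`; up to sign it is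
`R ∧ v₁ ∧ ⋯ ∧ vₙ` for an ordering of the inner vertices. A local orientation at an inner vertex
is an orientation of its three half-edges; up to sign it is `root ∧ A ∧ B` for an ordering of the
two incoming half-edges. -/

/-- A forest on `S` with an ordering `v₁, …, vₙ` of its inner vertices and, at each inner vertex,
an ordering `(A, B)` of the two incoming half-edges. It represents the inner-oriented forest with
global orientation `R ∧ v₁ ∧ ⋯ ∧ vₙ` and local orientations `root ∧ A ∧ B`. -/
@[ext] structure OrientedForest {α : Type*} [DecidableEq α] (S : Finset α) where
  vertices : List (Finset α × Finset α)
  nodup : (vertices.map (fun v => s(v.1, v.2))).Nodup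
  isForest : IsForest S (vertices.map (fun v => s(v.1, v.2))).toFinset

section Oriented

variable {α : Type*} [DecidableEq α]

namespace OrientedForest

variable {S T : Finset α}

/-- The set of (unoriented) inner vertices. -/
def vertexSet (F : OrientedForest S) : Finset (Sym2 (Finset α)) :=
  (F.vertices.map (fun v => s(v.1, v.2))).toFinset

/-- The trees of the forest, each given by its set of leaves. -/
def trees (F : OrientedForest S) : Finset (Finset α) := roots S F.vertexSet

/-- Two elementary ways of reversing the orientation: exchanging two consecutive inner vertices in
the global orientation, or exchanging the two incoming half-edges in one local orientation. -/
inductive Opposite (F G : OrientedForest S) : Prop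
  | swap (l₁ l₂ : List (Finset α × Finset α)) (v w : Finset α × Finset α)
      (hF : F.vertices = l₁ ++ v :: w :: l₂) (hG : G.vertices = l₁ ++ w :: v :: l₂) : Opposite F G
  | flip (l₁ l₂ : List (Finset α × Finset α)) (A B : Finset α)
      (hF : F.vertices = l₁ ++ (A, B) :: l₂) (hG : G.vertices = l₁ ++ (B, A) :: l₂) : Opposite F G

theorem disjoint_vertexSet (h : Disjoint S T) (F : OrientedForest S) (G : OrientedForest T) :
    Disjoint F.vertexSet G.vertexSet := by
  rw [Finset.disjoint_left]
  intro v hF hG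
  obtain ⟨x, hx⟩ := F.isForest.vertexLeaves_nonempty hF
  exact Finset.disjoint_left.1 h ((F.isForest.vertex v hF).1 hx) ((G.isForest.vertex v hG).1 hx)

/-- The disjoint union `(o₁ ⊔ o₂) ⊗ (F ⊔ G)`; the global orientation is obtained from
`o₁ ∧ r ∧ o₂` by replacing `R₁ ∧ r ∧ R₂` by `R`, so that
`R₁ ∧ v₁ ∧ ⋯ ∧ vₘ` and `R₂ ∧ w₁ ∧ ⋯ ∧ wₙ` give `R ∧ v₁ ∧ ⋯ ∧ vₘ ∧ w₁ ∧ ⋯ ∧ wₙ`. -/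
def disjointUnion (h : Disjoint S T) (F : OrientedForest S) (G : OrientedForest T) :
    OrientedForest (S ∪ T) where
  vertices := F.vertices ++ G.vertices
  nodup := by
    rw [List.map_append, List.nodup_append']
    refine ⟨F.nodup, G.nodup, ?_⟩
    intro v hv hw
    exact Finset.disjoint_left.1 (disjoint_vertexSet h F G) (List.mem_toFinset.2 hv)
      (List.mem_toFinset.2 hw)
  isForest := by
    rw [List.map_append, List.toFinset_append]
    exact F.isForest.union G.isForest h

/-- The forest obtained from `F ⊔ G` by joining the tree `r` of `F` and the tree `s` of `G` by a
new inner vertex `v`. The global orientation is `(-1)^{o₁} o₁ ∧ o₂` with `R₁ ∧ R₂` replaced by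
`R ∧ v`, so that `R₁ ∧ v₁ ∧ ⋯ ∧ vₘ` and `R₂ ∧ w₁ ∧ ⋯ ∧ wₙ` give
`R ∧ v ∧ v₁ ∧ ⋯ ∧ vₘ ∧ w₁ ∧ ⋯ ∧ wₙ`. The local orientation at `v` is `root ∧ r ∧ s`. -/
def graft (h : Disjoint S T) (F : OrientedForest S) (G : OrientedForest T) {r s : Finset α}
    (hr : r ∈ F.trees) (hs : s ∈ G.trees) : OrientedForest (S ∪ T) where
  vertices := (r, s) :: (F.vertices ++ G.vertices)
  nodup := by
    rw [List.map_cons, List.nodup_cons]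
    refine ⟨?_, (disjointUnion h F G).nodup⟩
    intro hm
    obtain ⟨⟨x, hx⟩, hrS⟩ := F.isForest.of_mem_roots hr
    obtain ⟨⟨y, hy⟩, hsT⟩ := G.isForest.of_mem_roots hs
    rw [List.map_append, List.mem_append] at hm
    rcases hm with hm | hm
    · have h₁ := (F.isForest.vertex _ (List.mem_toFinset.2 hm)).1
      exact Finset.disjoint_left.1 h (h₁ (Finset.mem_union_right _ hy)) (hsT hy)
    · have h₁ := (G.isForest.vertex _ (List.mem_toFinset.2 hm)).1
      exact Finset.disjoint_left.1 h (hrS hx) (h₁ (Finset.mem_union_left _ hx))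
  isForest := by
    rw [List.map_cons, List.toFinset_cons, List.map_append, List.toFinset_append]
    exact F.isForest.graft G.isForest h hr hs

/-- The forest with no inner vertex. -/
def noVertex (hS : S.Nonempty) : OrientedForest S where
  vertices := []
  nodup := List.nodup_nil
  isForest := IsForest.noVertex hS

theorem Opposite.length_eq {F G : OrientedForest S} (h : Opposite F G) :
    F.vertices.length = G.vertices.length := by
  cases h with
  | swap l₁ l₂ v w hF hG => simp [hF, hG]
  | flip l₁ l₂ A B hF hG => simp [hF, hG]

theorem Opposite.vertexSet_eq {F G : OrientedForest S} (h : Opposite F G) :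
    F.vertexSet = G.vertexSet := by
  cases h with
  | swap l₁ l₂ v w hF hG =>
    ext x
    simp only [vertexSet, hF, hG, List.map_append, List.map_cons, List.mem_toFinset,
      List.mem_append, List.mem_cons]
    tauto
  | flip l₁ l₂ A B hF hG => simp [vertexSet, hF, hG, Sym2.eq_swap (a := A)]

theorem Opposite.trees_eq {F G : OrientedForest S} (h : Opposite F G) : F.trees = G.trees := by
  rw [trees, trees, h.vertexSet_eq]

end OrientedForest

/-- The relations `F = -G` for opposite inner-oriented forests. -/
noncomputable def orientationRel (S : Finset α) : Submodule ℚ (OrientedForest S →₀ ℚ) :=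
  Submodule.span ℚ
    {x | ∃ F G : OrientedForest S, F.Opposite G ∧ x = Finsupp.single F 1 + Finsupp.single G 1}

/-- The vector space `Bess(S)` spanned by inner-oriented forests on `S`. -/
abbrev Bess (S : Finset α) : Type _ := (OrientedForest S →₀ ℚ) ⧸ orientationRel S

/-- The element of `Bess(S)` given by an inner-oriented forest. -/
noncomputable def cls {S : Finset α} (F : OrientedForest S) : Bess S :=
  (orientationRel S).mkQ (Finsupp.single F 1)

theorem cls_add_cls {S : Finset α} {F G : OrientedForest S} (h : F.Opposite G) :
    cls F + cls G = 0 := by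
  rw [cls, cls, ← map_add, Submodule.mkQ_apply, Submodule.Quotient.mk_eq_zero]
  exact Submodule.subset_span ⟨F, G, h, rfl⟩

/-- A function on inner-oriented forests changing sign under a change of orientation extends to a
linear map on `Bess(S)`. -/
noncomputable def liftBess {S : Finset α} {M : Type*} [AddCommGroup M] [Module ℚ M]
    (f : OrientedForest S → M) (hf : ∀ F G, F.Opposite G → f F + f G = 0) : Bess S →ₗ[ℚ] M :=
  (orientationRel S).liftQ (Finsupp.linearCombination ℚ f) <| by
    rw [orientationRel, Submodule.span_le]
    rintro _ ⟨F, G, h, rfl⟩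
    simpa using hf F G h

@[simp] theorem liftBess_cls {S : Finset α} {M : Type*} [AddCommGroup M] [Module ℚ M]
    (f : OrientedForest S → M) (hf : ∀ F G, F.Opposite G → f F + f G = 0)
    (F : OrientedForest S) : liftBess f hf (cls F) = f F := by
  simp [liftBess, cls, Submodule.liftQ_apply]

theorem hom_ext {S : Finset α} {M : Type*} [AddCommGroup M] [Module ℚ M]
    {f g : Bess S →ₗ[ℚ] M} (h : ∀ F, f (cls F) = g (cls F)) : f = g := by
  apply Submodule.linearMap_qext
  apply Finsupp.lhom_ext'
  intro F
  apply LinearMap.ext_ring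
  exact h F

/-- The component of `Bess(S)` of degree `n`; the degree is the number of inner vertices. -/
noncomputable def component (S : Finset α) (n : ℕ) : Submodule ℚ (Bess S) :=
  Submodule.span ℚ {x | ∃ F : OrientedForest S, F.vertices.length = n ∧ x = cls F}

/-- The projection of `Bess(S)` onto its component of degree `n`. -/
noncomputable def proj (S : Finset α) (n : ℕ) : Bess S →ₗ[ℚ] component S n :=
  liftBess
    (fun F => if h : F.vertices.length = n then ⟨cls F, Submodule.subset_span ⟨F, h, rfl⟩⟩ else 0)
    (by
      intro F G h
      by_cases hF : F.vertices.length = n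
      · have hG : G.vertices.length = n := h.length_eq ▸ hF
        rw [dif_pos hF, dif_pos hG]
        exact Subtype.ext (cls_add_cls h)
      · have hG : ¬ G.vertices.length = n := h.length_eq ▸ hF
        rw [dif_neg hF, dif_neg hG, add_zero])

/-- The endomorphism of `Bess(S)` projecting onto the component of degree `n`. -/
noncomputable def projEnd (S : Finset α) (n : ℕ) : Bess S →ₗ[ℚ] Bess S :=
  (component S n).subtype ∘ₗ proj S n

/-- The endomorphism of `Bess(S)` acting by `(-1)^n` in degree `n`. -/
noncomputable def parity (S : Finset α) : Bess S →ₗ[ℚ] Bess S :=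
  ∑ n ∈ Finset.range (S.card + 1), (-1 : ℚ) ^ n • projEnd S n

/-! ### The composition with the generators `E` and `Ω` of the operad -/

section Generators

variable {S T : Finset α}

theorem cls_disjointUnion_left (h : Disjoint S T) {F F' : OrientedForest S} (hF : F.Opposite F')
    (G : OrientedForest T) : cls (F.disjointUnion h G) + cls (F'.disjointUnion h G) = 0 := by
  apply cls_add_cls
  cases hF with
  | swap l₁ l₂ v w h₁ h₂ =>
    exact .swap l₁ (l₂ ++ G.vertices) v w (by simp [OrientedForest.disjointUnion, h₁])
      (by simp [OrientedForest.disjointUnion, h₂])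
  | flip l₁ l₂ A B h₁ h₂ =>
    exact .flip l₁ (l₂ ++ G.vertices) A B (by simp [OrientedForest.disjointUnion, h₁])
      (by simp [OrientedForest.disjointUnion, h₂])

theorem cls_disjointUnion_right (h : Disjoint S T) (F : OrientedForest S)
    {G G' : OrientedForest T} (hG : G.Opposite G') :
    cls (F.disjointUnion h G) + cls (F.disjointUnion h G') = 0 := by
  apply cls_add_cls
  cases hG with
  | swap l₁ l₂ v w h₁ h₂ =>
    exact .swap (F.vertices ++ l₁) l₂ v w (by simp [OrientedForest.disjointUnion, h₁])
      (by simp [OrientedForest.disjointUnion, h₂])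
  | flip l₁ l₂ A B h₁ h₂ =>
    exact .flip (F.vertices ++ l₁) l₂ A B (by simp [OrientedForest.disjointUnion, h₁])
      (by simp [OrientedForest.disjointUnion, h₂])

/-- The operation `(x, y) ↦ E_{⋆,#} ∘_⋆ x ∘_# y`, given on inner-oriented forests by
`(o₁ ⊔ o₂) ⊗ (F ⊔ G)`. -/
noncomputable def compE (h : Disjoint S T) : Bess S →ₗ[ℚ] Bess T →ₗ[ℚ] Bess (S ∪ T) :=
  liftBess
    (fun F => liftBess (fun G => cls (F.disjointUnion h G))
      (fun _ _ hG => cls_disjointUnion_right h F hG))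
    (by
      intro F F' hF
      apply hom_ext
      intro G
      simpa using cls_disjointUnion_left h hF G)

/-- The sum `(o₁ ∨ o₂) ⊗ (F ∨ G)` over all pairs of a tree of `F` and a tree of `G`, where these
two trees are joined by a new inner vertex. -/
noncomputable def graftSum (h : Disjoint S T) (F : OrientedForest S) (G : OrientedForest T) :
    Bess (S ∪ T) :=
  ∑ r ∈ F.trees.attach, ∑ s ∈ G.trees.attach, cls (F.graft h G r.2 s.2)

theorem cls_graft_left (h : Disjoint S T) {F F' : OrientedForest S} (hF : F.Opposite F')
    (G : OrientedForest T) {r s : Finset α} (hr : r ∈ F.trees) (hr' : r ∈ F'.trees)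
    (hs : s ∈ G.trees) : cls (F.graft h G hr hs) + cls (F'.graft h G hr' hs) = 0 := by
  apply cls_add_cls
  cases hF with
  | swap l₁ l₂ v w h₁ h₂ =>
    exact .swap ((r, s) :: l₁) (l₂ ++ G.vertices) v w (by simp [OrientedForest.graft, h₁])
      (by simp [OrientedForest.graft, h₂])
  | flip l₁ l₂ A B h₁ h₂ =>
    exact .flip ((r, s) :: l₁) (l₂ ++ G.vertices) A B (by simp [OrientedForest.graft, h₁])
      (by simp [OrientedForest.graft, h₂])

theorem cls_graft_right (h : Disjoint S T) (F : OrientedForest S) {G G' : OrientedForest T}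
    (hG : G.Opposite G') {r s : Finset α} (hr : r ∈ F.trees) (hs : s ∈ G.trees)
    (hs' : s ∈ G'.trees) : cls (F.graft h G hr hs) + cls (F.graft h G' hr hs') = 0 := by
  apply cls_add_cls
  cases hG with
  | swap l₁ l₂ v w h₁ h₂ =>
    exact .swap ((r, s) :: (F.vertices ++ l₁)) l₂ v w (by simp [OrientedForest.graft, h₁])
      (by simp [OrientedForest.graft, h₂])
  | flip l₁ l₂ A B h₁ h₂ =>
    exact .flip ((r, s) :: (F.vertices ++ l₁)) l₂ A B (by simp [OrientedForest.graft, h₁])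
      (by simp [OrientedForest.graft, h₂])

theorem sum_attach_congr {β M : Type*} [AddCommMonoid M] {s t : Finset β} (h : s = t)
    (f : ∀ b ∈ s, M) :
    ∑ b ∈ s.attach, f b.1 b.2 = ∑ b ∈ t.attach, f b.1 (h ▸ b.2) := by
  subst h
  rfl

theorem graftSum_left (h : Disjoint S T) {F F' : OrientedForest S} (hF : F.Opposite F')
    (G : OrientedForest T) : graftSum h F G + graftSum h F' G = 0 := by
  rw [graftSum, graftSum, sum_attach_congr hF.trees_eq
    (fun r hr => ∑ s ∈ G.trees.attach, cls (F.graft h G hr s.2)), ← Finset.sum_add_distrib]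
  refine Finset.sum_eq_zero fun r _ => ?_
  rw [← Finset.sum_add_distrib]
  exact Finset.sum_eq_zero fun s _ => cls_graft_left h hF G _ _ _

theorem graftSum_right (h : Disjoint S T) (F : OrientedForest S) {G G' : OrientedForest T}
    (hG : G.Opposite G') : graftSum h F G + graftSum h F G' = 0 := by
  rw [graftSum, graftSum, ← Finset.sum_add_distrib]
  refine Finset.sum_eq_zero fun r _ => ?_
  rw [sum_attach_congr hG.trees_eq (fun s hs => cls (F.graft h G r.2 hs)),
    ← Finset.sum_add_distrib]
  exact Finset.sum_eq_zero fun s _ => cls_graft_right h F hG _ _ _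

/-- The operation `(x, y) ↦ Ω_{⋆,#} ∘_⋆ x ∘_# y`, given on inner-oriented forests by
`(o₁ ∨ o₂) ⊗ (F ∨ G)`. -/
noncomputable def compOmega (h : Disjoint S T) : Bess S →ₗ[ℚ] Bess T →ₗ[ℚ] Bess (S ∪ T) :=
  liftBess
    (fun F => liftBess (fun G => graftSum h F G) (fun _ _ hG => graftSum_right h F hG))
    (by
      intro F F' hF
      apply hom_ext
      intro G
      simpa using graftSum_left h hF G)

/-! ### The composition in the tensor square, with the Koszul sign rule -/

/-- The map `(x₁ ⊗ x₂) ⊗ (y₁ ⊗ y₂) ↦ (-1)^{|x₂||y₁|} (x₁ ⊗ y₁) ⊗ (x₂ ⊗ y₂)`. -/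
noncomputable def koszul (S T : Finset α) :
    (Bess S ⊗[ℚ] Bess S) ⊗[ℚ] (Bess T ⊗[ℚ] Bess T) →ₗ[ℚ]
      (Bess S ⊗[ℚ] Bess T) ⊗[ℚ] (Bess S ⊗[ℚ] Bess T) :=
  ∑ p ∈ Finset.range (S.card + 1), ∑ q ∈ Finset.range (T.card + 1), (-1 : ℚ) ^ (p * q) •
    ((TensorProduct.tensorTensorTensorComm ℚ (Bess S) (Bess S) (Bess T) (Bess T)).toLinearMap ∘ₗ
      TensorProduct.map (TensorProduct.map LinearMap.id (projEnd S p))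
        (TensorProduct.map (projEnd T q) LinearMap.id))

/-- For `X = x₁ ⊗ x₂` and `Y = y₁ ⊗ y₂`, the element `(μ ⊗ ν)_{⋆,#} ∘_⋆ X ∘_# Y` when `ν` has
degree `0`, that is `(-1)^{|x₂||y₁|} μ(x₁, y₁) ⊗ ν(x₂, y₂)`. -/
noncomputable def compTensor (μ ν : Bess S →ₗ[ℚ] Bess T →ₗ[ℚ] Bess (S ∪ T))
    (X : Bess S ⊗[ℚ] Bess S) (Y : Bess T ⊗[ℚ] Bess T) : Bess (S ∪ T) ⊗[ℚ] Bess (S ∪ T) :=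
  TensorProduct.map (TensorProduct.lift μ) (TensorProduct.lift ν) (koszul S T (X ⊗ₜ[ℚ] Y))

/-- The same element `(μ ⊗ ν)_{⋆,#} ∘_⋆ X ∘_# Y` when `ν` has degree `1`, that is
`(-1)^{|x₁| + |y₁| + |x₂||y₁|} μ(x₁, y₁) ⊗ ν(x₂, y₂)`: the operation `ν` passes `x₁` and `y₁`. -/
noncomputable def compTensorOdd (μ ν : Bess S →ₗ[ℚ] Bess T →ₗ[ℚ] Bess (S ∪ T))
    (X : Bess S ⊗[ℚ] Bess S) (Y : Bess T ⊗[ℚ] Bess T) : Bess (S ∪ T) ⊗[ℚ] Bess (S ∪ T) :=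
  compTensor μ ν (TensorProduct.map (parity S) LinearMap.id X)
    (TensorProduct.map (parity T) LinearMap.id Y)

end Generators

/-- The family `Δ` is the morphism of operads from `Bess` to `Bess ⊗ Bess` given on generators by
`Δ(E) = E ⊗ E` and `Δ(Ω) = E ⊗ Ω + Ω ⊗ E`: it maps the unit to the unit and commutes with the
composition with the generators. -/
structure IsCoproduct (Δ : ∀ S : Finset α, Bess S →ₗ[ℚ] Bess S ⊗[ℚ] Bess S) : Prop where
  unit : ∀ a : α,
    Δ {a} (cls (.noVertex (Finset.singleton_nonempty a))) =
      cls (.noVertex (Finset.singleton_nonempty a)) ⊗ₜ[ℚ]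
        cls (.noVertex (Finset.singleton_nonempty a))
  compE : ∀ (S T : Finset α) (h : Disjoint S T) (x : Bess S) (y : Bess T),
    Δ (S ∪ T) (compE h x y) = compTensor (compE h) (compE h) (Δ S x) (Δ T y)
  compOmega : ∀ (S T : Finset α) (h : Disjoint S T) (x : Bess S) (y : Bess T),
    Δ (S ∪ T) (compOmega h x y) =
      compTensorOdd (Bessel.compE h) (Bessel.compOmega h) (Δ S x) (Δ T y) +
        compTensor (Bessel.compOmega h) (Bessel.compE h) (Δ S x) (Δ T y)

/-- The element of degree zero given by the forest with no inner vertex (with orientation `R`). -/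
noncomputable def unitForest (S : Finset α) (hS : S.Nonempty) : component S 0 :=
  ⟨cls (.noVertex hS), Submodule.subset_span ⟨.noVertex hS, rfl, rfl⟩⟩

end Oriented

end Bessel

namespace Bessel

/-! ### Combinatorics of forests -/

section Combinatorics

variable {α : Type*} [DecidableEq α] {S T : Finset α} {V W : Finset (Sym2 (Finset α))}

/-! The coproduct has a closed formula. For a forest `F` with ordered vertices, distribute the
vertices between two sublists `L` and `R` in all ways, with the sign of the unshuffle, and take the
sum of `[L] ⊗ [R]` (`listCoproduct`). The vertices in `L` need not form a forest: once the vertices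
above an edge with leaf set `A` are gone, `A` falls apart into several trees, and one has to sum
over the tree that is joined. Accordingly `[L]` is `refineCls S L`, the sum of all forests obtained
by shrinking every `(A, B)` to some `(a, b)` with `a ⊆ A` and `b ⊆ B`; choices that give no forest
count as zero. Both constructions are alternating, so the formula descends to `Bess S`.

Compatibility with `E` says that unshuffling and refining respect concatenation of lists
(`unshuffleSum_append`, `refineCls_append`); the sign that appears is the Koszul sign. For `Ω`, the
new vertex stands first in the list and goes either left, which gives `Ω ⊗ E`, or right past all
left vertices, which gives `E ⊗ Ω` with its sign. The remaining identity is `sum_refineCls_graft`: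
each tree of a finer forest lies in exactly one tree of the coarse one, so refining the new vertex
produces every graft of the finer forests exactly once.

Uniqueness holds because every forest is, up to sign, built from single leaves by `E` and `Ω`
(`IsForest.cls_mem`); hence families of maps are compared on generators (`family_ext`).

For the counit, projecting one factor to degree zero leaves only the splitting in which that factor
receives no vertex. The other factor is then `refineCls S F.vertices`, which equals `cls F`
(`refineCls_vertices`), again by comparison on generators. -/

theorem vertexLeaves_subset_of_mem {r : Finset α} {v : Sym2 (Finset α)} (h : r ∈ v) :
    r ⊆ vertexLeaves v := by
  induction v with
  | _ A B =>
    rcases Sym2.mem_iff.1 h with rfl | rfl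
    · exact Finset.subset_union_left
    · exact Finset.subset_union_right

theorem mem_roots {r : Finset α} : r ∈ roots S V ↔
    ((∃ a ∈ S, {a} = r) ∨ ∃ v ∈ V, vertexLeaves v = r) ∧ ∀ v ∈ V, r ∉ v := by
  simp [roots]

theorem IsForest.not_subset_of_mem {X r : Finset α} (hV : IsForest S V) (hd : Disjoint S X)
    (hr : r ⊆ X) {v : Sym2 (Finset α)} (hv : v ∈ V) : r ∉ v := by
  intro h
  obtain ⟨hvS, h'⟩ := hV.vertex v hv
  obtain ⟨x, hx⟩ := (h' r h).1
  exact Finset.disjoint_left.1 hd (hvS ((h' r h).2.1 hx)) (hr hx)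

/-- An incoming edge of a vertex is a nonempty set of leaves of its own forest, so no vertex of one
forest can sit below a tree of the other. -/
theorem roots_union (hV : IsForest S V) (hW : IsForest T W) (hd : Disjoint S T) :
    roots (S ∪ T) (V ∪ W) = roots S V ∪ roots T W := by
  ext r
  rw [Finset.mem_union]
  constructor
  · intro hr
    rw [mem_roots] at hr
    obtain ⟨hr, hn⟩ := hr
    simp only [Finset.mem_union, or_and_right, exists_or] at hr hn
    simp only [mem_roots]
    have h₁ : ∀ v ∈ V, r ∉ v := fun v hv => hn v (Or.inl hv)
    have h₂ : ∀ v ∈ W, r ∉ v := fun v hv => hn v (Or.inr hv)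
    rcases hr with (h | h) | (h | h)
    · exact Or.inl ⟨Or.inl h, h₁⟩
    · exact Or.inr ⟨Or.inl h, h₂⟩
    · exact Or.inl ⟨Or.inr h, h₁⟩
    · exact Or.inr ⟨Or.inr h, h₂⟩
  · rintro (hr | hr)
    · have hrS := (hV.of_mem_roots hr).2
      rw [mem_roots] at hr ⊢
      refine ⟨?_, fun v hv => ?_⟩
      · rcases hr.1 with ⟨a, ha, e⟩ | ⟨v, hv, e⟩
        · exact Or.inl ⟨a, Finset.mem_union_left _ ha, e⟩
        · exact Or.inr ⟨v, Finset.mem_union_left _ hv, e⟩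
      · rcases Finset.mem_union.1 hv with hv | hv
        · exact hr.2 v hv
        · exact hW.not_subset_of_mem hd.symm hrS hv
    · have hrT := (hW.of_mem_roots hr).2
      rw [mem_roots] at hr ⊢
      refine ⟨?_, fun v hv => ?_⟩
      · rcases hr.1 with ⟨a, ha, e⟩ | ⟨v, hv, e⟩
        · exact Or.inl ⟨a, Finset.mem_union_right _ ha, e⟩
        · exact Or.inr ⟨v, Finset.mem_union_right _ hv, e⟩
      · rcases Finset.mem_union.1 hv with hv | hv
        · exact hV.not_subset_of_mem hd hrT hv
        · exact hr.2 v hv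

theorem IsTree.roots_eq (h : IsTree S V) : roots S V = {S} := by
  refine Finset.eq_singleton_iff_unique_mem.2 ⟨mem_roots.2 ⟨?_, fun v hv hS => ?_⟩,
    fun r => h.eq_of_mem_roots⟩
  · cases h with
    | leaf a => exact Or.inl ⟨a, by simp, rfl⟩
    | graft _ _ _ => exact Or.inr ⟨_, Finset.mem_insert_self _ _, rfl⟩
  · have := h.vertex v hv
    exact (this.2 S hS).2.2 this.1

theorem IsForest.roots_pairwiseDisjoint (h : IsForest S V) :
    ∀ r ∈ roots S V, ∀ s ∈ roots S V, r ≠ s → Disjoint r s := by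
  induction h with
  | tree h => simp +contextual [h.roots_eq]
  | @union S T V W hV hW hd h₁ h₂ =>
    intro r hr s hs hrs
    rw [roots_union hV hW hd, Finset.mem_union] at hr hs
    rcases hr with hr | hr <;> rcases hs with hs | hs
    · exact h₁ r hr s hs hrs
    · exact hd.mono (hV.of_mem_roots hr).2 (hW.of_mem_roots hs).2
    · exact hd.symm.mono (hW.of_mem_roots hr).2 (hV.of_mem_roots hs).2
    · exact h₂ r hr s hs hrs

theorem IsForest.exists_root_of_mem (h : IsForest S V) {a : α} (ha : a ∈ S) :
    ∃ r ∈ roots S V, a ∈ r := by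
  induction h with
  | tree h => simpa [h.roots_eq] using ha
  | @union S T V W hV hW hd h₁ h₂ =>
    rw [roots_union hV hW hd]
    rcases Finset.mem_union.1 ha with ha | ha
    · obtain ⟨r, hr, har⟩ := h₁ ha
      exact ⟨r, Finset.mem_union_left _ hr, har⟩
    · obtain ⟨r, hr, har⟩ := h₂ ha
      exact ⟨r, Finset.mem_union_right _ hr, har⟩

theorem IsForest.exists_root_of_vertex (h : IsForest S V) {v : Sym2 (Finset α)} (hv : v ∈ V) :
    ∃ r ∈ roots S V, vertexLeaves v ⊆ r := by
  induction h with
  | tree h => simpa [h.roots_eq] using (h.vertex v hv).1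
  | @union S T V W hV hW hd h₁ h₂ =>
    rw [roots_union hV hW hd]
    rcases Finset.mem_union.1 hv with hv | hv
    · obtain ⟨r, hr, har⟩ := h₁ hv
      exact ⟨r, Finset.mem_union_left _ hr, har⟩
    · obtain ⟨r, hr, har⟩ := h₂ hv
      exact ⟨r, Finset.mem_union_right _ hr, har⟩

/-- Each inner vertex merges two trees into one. The bound guarantees that the ranges up to `S.card`
in `parity` and `koszul` reach every degree that occurs. -/
theorem IsTree.card_lt (h : IsTree S V) : V.card < S.card := by
  induction h with
  | leaf a => simp
  | @graft S T V W _ _ hd h₁ h₂ =>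
    rw [Finset.card_union_of_disjoint hd]
    have i := Finset.card_insert_le s(S, T) (V ∪ W)
    have u := Finset.card_union_le V W
    omega

theorem IsForest.card_lt (h : IsForest S V) : V.card < S.card := by
  induction h with
  | tree h => exact h.card_lt
  | union _ _ hd h₁ h₂ =>
    rw [Finset.card_union_of_disjoint hd]
    refine lt_of_le_of_lt (Finset.card_union_le _ _) ?_
    omega

/-- A forest restricts to any union of sets of leaves of some of its trees. -/
theorem IsForest.restrict {X : Finset α} (h : IsForest X V) (hS : S.Nonempty) (hSX : S ⊆ X)
    (hV : ∀ v ∈ V, vertexLeaves v ⊆ S ∨ Disjoint (vertexLeaves v) S) :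
    IsForest S (V.filter (vertexLeaves · ⊆ S)) := by
  induction h generalizing S with
  | @tree X V h =>
    -- The lowest vertex of a tree carries all its leaves, hence meets `S`, and the hypothesis then
    -- forces the whole tree into `S`.
    have hX : X ⊆ S := by
      cases h with
      | leaf a =>
        obtain ⟨x, hx⟩ := hS
        have := Finset.mem_singleton.1 (hSX hx)
        simpa [← this] using hx
      | graft _ _ _ =>
        refine (hV _ (Finset.mem_insert_self _ _)).resolve_right fun hd => ?_
        obtain ⟨x, hx⟩ := hS
        exact Finset.disjoint_left.1 hd (hSX hx) hx
    obtain rfl := hX.antisymm hSX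
    rw [Finset.filter_true_of_mem fun v hv => (h.vertex v hv).1]
    exact .tree h
  | @union X Y V W hX hY hd h₁ h₂ =>
    have eV : ∀ v ∈ V, (vertexLeaves v ⊆ S ↔ vertexLeaves v ⊆ S ∩ X) := fun v hv =>
      ⟨fun h => Finset.subset_inter h (hX.vertex v hv).1, fun h => h.trans Finset.inter_subset_left⟩
    have eW : ∀ v ∈ W, (vertexLeaves v ⊆ S ↔ vertexLeaves v ⊆ S ∩ Y) := fun v hv =>
      ⟨fun h => Finset.subset_inter h (hY.vertex v hv).1, fun h => h.trans Finset.inter_subset_left⟩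
    have hV₁ : ∀ v ∈ V, vertexLeaves v ⊆ S ∩ X ∨ Disjoint (vertexLeaves v) (S ∩ X) :=
      fun v hv => (hV v (Finset.mem_union_left _ hv)).imp (eV v hv).1
        fun h => h.mono_right Finset.inter_subset_left
    have hW₁ : ∀ v ∈ W, vertexLeaves v ⊆ S ∩ Y ∨ Disjoint (vertexLeaves v) (S ∩ Y) :=
      fun v hv => (hV v (Finset.mem_union_right _ hv)).imp (eW v hv).1
        fun h => h.mono_right Finset.inter_subset_left
    have hS' : S = S ∩ X ∪ S ∩ Y := by
      rw [← Finset.inter_union_distrib_left, Finset.inter_eq_left.2 hSX]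
    rw [Finset.filter_union, Finset.filter_congr eV, Finset.filter_congr eW]
    have f₁ := fun hne => h₁ (S := S ∩ X) hne Finset.inter_subset_right hV₁
    have f₂ := fun hne => h₂ (S := S ∩ Y) hne Finset.inter_subset_right hW₁
    -- `IsForest` excludes the empty set of leaves, so a side that does not meet `S` is treated
    -- apart: it contributes no vertex.
    rcases (S ∩ X).eq_empty_or_nonempty with e₁ | n₁
    · have : V.filter (vertexLeaves · ⊆ S ∩ X) = ∅ := by
        refine Finset.filter_false_of_mem fun v hv hs => ?_
        exact (hX.vertexLeaves_nonempty hv).ne_empty (Finset.subset_empty.1 (e₁ ▸ hs))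
      rw [this, Finset.empty_union]
      rw [e₁, Finset.empty_union] at hS'
      rw [← hS'] at f₂ ⊢
      exact f₂ hS
    · rcases (S ∩ Y).eq_empty_or_nonempty with e₂ | n₂
      · have : W.filter (vertexLeaves · ⊆ S ∩ Y) = ∅ := by
          refine Finset.filter_false_of_mem fun v hv hs => ?_
          exact (hY.vertexLeaves_nonempty hv).ne_empty (Finset.subset_empty.1 (e₂ ▸ hs))
        rw [this, Finset.union_empty]
        rw [e₂, Finset.union_empty] at hS'
        rw [← hS'] at f₁ ⊢
        exact f₁ hS
      · rw [hS']
        have := (f₁ n₁).union (f₂ n₂)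
          (hd.mono Finset.inter_subset_right Finset.inter_subset_right)
        rwa [← hS'] at this ⊢

/-- Removing the lowest vertex of a tree of a forest leaves a forest. -/
theorem IsForest.erase_root {A B : Finset α} (h : IsForest S V) (hv : s(A, B) ∈ V)
    (hm : ∀ v ∈ V, A ∪ B ∉ v) :
    IsForest S (V.erase s(A, B)) ∧ A ∈ roots S (V.erase s(A, B)) ∧
      B ∈ roots S (V.erase s(A, B)) := by
  -- In a tree on `A ∪ B`, the vertex `s(A, B)` must be the last graft: the vertices of either
  -- branch miss the leaves of the other branch.
  have tree : ∀ {V : Finset (Sym2 (Finset α))}, IsTree (A ∪ B) V → s(A, B) ∈ V →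
      IsForest (A ∪ B) (V.erase s(A, B)) ∧ A ∈ roots (A ∪ B) (V.erase s(A, B)) ∧
      B ∈ roots (A ∪ B) (V.erase s(A, B)) := by
    intro V ht hv
    generalize hX : A ∪ B = X at ht
    cases ht with
    | leaf a => simp at hv
    | @graft P Q V W hV hW hd =>
      have sub : ∀ {P Q : Finset α} {V : Finset (Sym2 (Finset α))}, IsTree P V → Q.Nonempty →
          Disjoint P Q → P ∪ Q ⊆ A ∪ B → s(A, B) ∉ V := by
        intro P Q V hV hQ hd hs hm
        obtain ⟨x, hx⟩ := hQ
        exact Finset.disjoint_right.1 hd hx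
          ((hV.vertex _ hm).1 (hs (Finset.mem_union_right _ hx)))
      have nV : s(A, B) ∉ V := sub hV hW.nonempty hd hX.symm.subset
      have nW : s(A, B) ∉ W :=
        sub hW hV.nonempty hd.symm (by rw [Finset.union_comm]; exact hX.symm.subset)
      have e : s(A, B) = s(P, Q) := by
        simpa [nV, nW] using hv
      rw [e] at nV nW ⊢
      rw [Finset.erase_insert (by simp [nV, nW]),
        roots_union (.tree hV) (.tree hW) hd, hV.roots_eq, hW.roots_eq]
      refine ⟨(IsForest.tree hV).union (.tree hW) hd, ?_⟩
      rcases Sym2.eq_iff.1 e with ⟨rfl, rfl⟩ | ⟨rfl, rfl⟩ <;> simp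
  have hr : A ∪ B ∈ roots S V := mem_roots.2 ⟨Or.inr ⟨_, hv, rfl⟩, hm⟩
  rcases h.split hr with ⟨rfl, ht⟩ | ⟨S', V₁, V₂, hd, rfl, rfl, ht, hf⟩
  · exact tree ht hv
  · have n₂ : s(A, B) ∉ V₂ := by
      intro h₂
      obtain ⟨x, hx⟩ := ht.nonempty
      exact Finset.disjoint_left.1 hd hx ((hf.vertex _ h₂).1 hx)
    have h₁ : s(A, B) ∈ V₁ := (Finset.mem_union.1 hv).resolve_right n₂
    obtain ⟨hF, hA, hB⟩ := tree ht h₁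
    rw [Finset.erase_union_distrib, Finset.erase_eq_of_notMem n₂, roots_union hF hf hd]
    exact ⟨hF.union hf hd, Finset.mem_union_left _ hA, Finset.mem_union_left _ hB⟩

end Combinatorics

end Bessel

namespace Bessel

/-! ### Alternating functions on lists of oriented vertices -/

section Lists

variable {α : Type*} {M N : Type*} [AddCommGroup M] [AddCommGroup N]

/-- A function on lists of oriented inner vertices which changes sign under the two elementary ways
of reversing the orientation. -/
structure IsAlt (f : List (Finset α × Finset α) → M) : Prop where
  swap : ∀ l₁ l₂ v w, f (l₁ ++ v :: w :: l₂) + f (l₁ ++ w :: v :: l₂) = 0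
  flip : ∀ l₁ l₂ A B, f (l₁ ++ (A, B) :: l₂) + f (l₁ ++ (B, A) :: l₂) = 0

theorem IsAlt.cons {f : List (Finset α × Finset α) → M} (hf : IsAlt f) (v : Finset α × Finset α) :
    IsAlt (fun l => f (v :: l)) :=
  ⟨fun l₁ => hf.swap (v :: l₁), fun l₁ => hf.flip (v :: l₁)⟩

theorem IsAlt.map [Module ℚ M] [Module ℚ N] {f : List (Finset α × Finset α) → M} (hf : IsAlt f) (g : M →ₗ[ℚ] N) :
    IsAlt (fun l => g (f l)) :=
  ⟨fun l₁ l₂ v w => by rw [← map_add, hf.swap, map_zero],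
    fun l₁ l₂ A B => by rw [← map_add, hf.flip, map_zero]⟩

theorem IsAlt.smul_length [Module ℚ M] {f : List (Finset α × Finset α) → M} (hf : IsAlt f) :
    IsAlt (fun l => (-1 : ℚ) ^ l.length • f l) :=
  ⟨fun l₁ l₂ v w => by
    simp only [List.length_append, List.length_cons]
    rw [← smul_add, hf.swap, smul_zero],
   fun l₁ l₂ A B => by
    simp only [List.length_append, List.length_cons]
    rw [← smul_add, hf.flip, smul_zero]⟩

theorem IsAlt.const_smul [Module ℚ M] {f : List (Finset α × Finset α) → M} (hf : IsAlt f) (c : ℚ) :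
    IsAlt (fun l => c • f l) :=
  hf.map (c • LinearMap.id)

/-- Adjacent swaps bring `v` to the front. The sign is left undetermined, since the result serves
only to decide membership in subspaces. -/
theorem IsAlt.move {f : List (Finset α × Finset α) → M} (hf : IsAlt f)
    (l₁ l₂ : List (Finset α × Finset α)) (v : Finset α × Finset α) :
    f (l₁ ++ v :: l₂) = f (v :: (l₁ ++ l₂)) ∨ f (l₁ ++ v :: l₂) = -f (v :: (l₁ ++ l₂)) := by
  induction l₁ generalizing f with
  | nil => exact Or.inl rfl
  | cons w l₁ ih =>
    have e := eq_neg_of_add_eq_zero_left (hf.swap [] (l₁ ++ l₂) w v)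
    simp only [List.nil_append] at e
    rcases ih (hf.cons w) with h | h
    · exact Or.inr (h.trans e)
    · exact Or.inl (h.trans (by rw [e, neg_neg]; rfl))

/-- The value of an alternating function is determined up to sign by the unoriented vertices. -/
theorem IsAlt.eq_or_eq_neg {f : List (Finset α × Finset α) → M} (hf : IsAlt f)
    {l l' : List (Finset α × Finset α)}
    (h : (l.map (fun v => s(v.1, v.2))).Perm (l'.map (fun v => s(v.1, v.2)))) :
    f l = f l' ∨ f l = -f l' := by
  induction l generalizing f l' with
  | nil =>
    have : l' = [] := by simpa using h
    exact Or.inl (by rw [this])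
  | cons v l ih =>
    have hv : s(v.1, v.2) ∈ l'.map (fun v => s(v.1, v.2)) := h.subset (by simp)
    obtain ⟨w, hw, e⟩ := List.mem_map.1 hv
    obtain ⟨l₁, l₂, rfl⟩ := List.append_of_mem hw
    have h₁ : (l.map (fun v => s(v.1, v.2))).Perm ((l₁ ++ l₂).map (fun v => s(v.1, v.2))) := by
      have : (s(v.1, v.2) :: l.map (fun v => s(v.1, v.2))).Perm
          (s(w.1, w.2) :: (l₁ ++ l₂).map (fun v => s(v.1, v.2))) := by
        refine h.trans ?_
        rw [List.map_append, List.map_append, List.map_cons]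
        exact List.perm_middle
      rw [e] at this
      exact this.cons_inv
    have h₂ : f (v :: (l₁ ++ l₂)) = f (w :: (l₁ ++ l₂)) ∨
        f (v :: (l₁ ++ l₂)) = -f (w :: (l₁ ++ l₂)) := by
      obtain ⟨A, B⟩ := v
      obtain ⟨C, D⟩ := w
      rcases Sym2.eq_iff.1 e with ⟨rfl, rfl⟩ | ⟨rfl, rfl⟩
      · exact Or.inl rfl
      · exact Or.inr (eq_neg_of_add_eq_zero_left (hf.flip [] _ _ _))
    rcases ih (hf.cons v) h₁ with h₃ | h₃ <;> rcases h₂ with h₂ | h₂ <;>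
      rcases hf.move l₁ l₂ w with h₄ | h₄ <;> simp [h₂, h₃, h₄]

/-! ### Signed sums over splittings of a list -/

section Unshuffle

variable [Module ℚ M] [Module ℚ N]

/-- The signed sum of `f L R` over all splittings of a list into two sublists `L` and `R`; the sign
is that of the permutation moving `L` in front of `R`. -/
def unshuffleSum : (List (Finset α × Finset α) → List (Finset α × Finset α) → M) →
    List (Finset α × Finset α) → M
  | f, [] => f [] []
  | f, v :: l => unshuffleSum (fun L R => f (v :: L) R) l +
      unshuffleSum (fun L R => (-1 : ℚ) ^ L.length • f L (v :: R)) l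

/-- The sublist hypotheses let conditions on the support of `l` pass to `L` and `R`. -/
theorem unshuffleSum_congr {f g : List (Finset α × Finset α) → List (Finset α × Finset α) → M}
    {l : List (Finset α × Finset α)}
    (h : ∀ L R, L.Sublist l → R.Sublist l → f L R = g L R) :
    unshuffleSum f l = unshuffleSum g l := by
  induction l generalizing f g with
  | nil => exact h [] [] .slnil .slnil
  | cons v l ih =>
    refine congrArg₂ (· + ·) (ih fun L R hL hR => ?_) (ih fun L R hL hR => ?_)
    · exact h _ R (hL.cons_cons v) (hR.cons v)
    · rw [h L _ (hL.cons v) (hR.cons_cons v)]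

theorem map_unshuffleSum (g : M →ₗ[ℚ] N)
    (f : List (Finset α × Finset α) → List (Finset α × Finset α) → M)
    (l : List (Finset α × Finset α)) :
    g (unshuffleSum f l) = unshuffleSum (fun L R => g (f L R)) l := by
  induction l generalizing f with
  | nil => rfl
  | cons v l ih => simp only [unshuffleSum, map_add, ih, map_smul]

theorem map_unshuffleSum₂ {M M' N : Type*} [AddCommGroup M] [Module ℚ M] [AddCommGroup M']
    [Module ℚ M'] [AddCommGroup N] [Module ℚ N]
    (B : M →ₗ[ℚ] M' →ₗ[ℚ] N)
    (f : List (Finset α × Finset α) → List (Finset α × Finset α) → M)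
    (g : List (Finset α × Finset α) → List (Finset α × Finset α) → M')
    (l m : List (Finset α × Finset α)) :
    B (unshuffleSum f l) (unshuffleSum g m) =
      unshuffleSum (fun L R => unshuffleSum (fun L' R' => B (f L R) (g L' R')) m) l := by
  rw [← LinearMap.flip_apply, map_unshuffleSum]
  congr 1
  funext L R
  rw [LinearMap.flip_apply, map_unshuffleSum]

theorem unshuffleSum_add (f g : List (Finset α × Finset α) → List (Finset α × Finset α) → M)
    (l : List (Finset α × Finset α)) :
    unshuffleSum f l + unshuffleSum g l = unshuffleSum (fun L R => f L R + g L R) l := by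
  induction l generalizing f g with
  | nil => rfl
  | cons v l ih => simp only [unshuffleSum, smul_add, ← ih]; abel

theorem unshuffleSum_zero (l : List (Finset α × Finset α)) :
    unshuffleSum (fun _ _ => (0 : M)) l = 0 := by
  induction l with
  | nil => rfl
  | cons v l ih => simp [unshuffleSum, ih]

theorem sum_unshuffleSum {ι : Type*} (s : Finset ι)
    (f : ι → List (Finset α × Finset α) → List (Finset α × Finset α) → M)
    (l : List (Finset α × Finset α)) :
    ∑ i ∈ s, unshuffleSum (f i) l = unshuffleSum (fun L R => ∑ i ∈ s, f i L R) l := by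
  classical
  induction s using Finset.induction_on with
  | empty => simp [unshuffleSum_zero]
  | insert i s hi ih => simp only [Finset.sum_insert hi, ih, unshuffleSum_add]

/-- Rearranging `L R L' R'` into `L L' R R'` moves `L'` past `R`; the resulting sign is that of the
middle exchange in `koszul`. -/
theorem unshuffleSum_append (f : List (Finset α × Finset α) → List (Finset α × Finset α) → M)
    (l l' : List (Finset α × Finset α)) :
    unshuffleSum f (l ++ l') = unshuffleSum (fun L R => unshuffleSum (fun L' R' =>
      (-1 : ℚ) ^ (R.length * L'.length) • f (L ++ L') (R ++ R')) l') l := by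
  induction l generalizing f with
  | nil => simp [unshuffleSum]
  | cons v l ih =>
    simp only [List.cons_append, unshuffleSum, ih]
    congr 2
    funext L R
    have h := map_unshuffleSum ((-1 : ℚ) ^ L.length • (LinearMap.id : M →ₗ[ℚ] M))
      (fun L' R' => (-1 : ℚ) ^ ((v :: R).length * L'.length) • f (L ++ L') (v :: R ++ R')) l'
    simp only [LinearMap.smul_apply, LinearMap.id_apply] at h
    simp only [List.cons_append] at h ⊢
    rw [h]
    congr 1
    funext L' R'
    simp only [smul_smul, List.length_append, List.length_cons]
    congr 1
    ring

theorem unshuffleSum_of_left {f : List (Finset α × Finset α) → List (Finset α × Finset α) → M}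
    (hf : ∀ L R, L ≠ [] → f L R = 0) (l : List (Finset α × Finset α)) :
    unshuffleSum f l = f [] l := by
  induction l generalizing f with
  | nil => rfl
  | cons v l ih =>
    rw [unshuffleSum, ih fun L R _ => hf _ _ (by simp), hf _ _ (by simp),
      ih fun L R hL => by rw [hf _ _ hL, smul_zero]]
    simp

theorem unshuffleSum_of_right {f : List (Finset α × Finset α) → List (Finset α × Finset α) → M}
    (hf : ∀ L R, R ≠ [] → f L R = 0) (l : List (Finset α × Finset α)) :
    unshuffleSum f l = f l [] := by
  induction l generalizing f with
  | nil => rfl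
  | cons v l ih =>
    rw [unshuffleSum, ih fun L R hR => hf _ _ hR, ih fun L R _ => by rw [hf _ _ (by simp), smul_zero],
      hf l [v] (by simp)]
    simp

/-- Under a swap of two neighbours, the terms with both on the same side cancel because `f` is
alternating in that argument. The terms with the two on different sides agree up to the unshuffle
sign, which changes because the right one crosses one more or one fewer left vertex. A flip acts on
one argument only. -/
theorem IsAlt.unshuffleSum {f : List (Finset α × Finset α) → List (Finset α × Finset α) → M}
    (h₁ : ∀ R, IsAlt (fun L => f L R)) (h₂ : ∀ L, IsAlt (f L)) : IsAlt (unshuffleSum f) where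
  swap l₁ l₂ v w := by
    induction l₁ generalizing f with
    | nil =>
      simp only [List.nil_append, Bessel.unshuffleSum, unshuffleSum_add]
      refine (unshuffleSum_congr fun L R _ _ => ?_).trans (unshuffleSum_zero l₂)
      have e₁ := eq_neg_of_add_eq_zero_left ((h₁ R).swap [] L v w)
      have e₂ := eq_neg_of_add_eq_zero_left ((h₂ L).swap [] R v w)
      simp only [List.nil_append] at e₁ e₂
      rw [e₁, e₂]
      simp only [List.length_cons, pow_succ, mul_neg, mul_one, neg_smul, smul_neg, smul_smul]
      abel
    | cons u l₁ ih =>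
      have i₁ := ih (f := fun L R => f (u :: L) R) (fun R => (h₁ R).cons u) (fun L => h₂ (u :: L))
      have i₂ := ih (f := fun L R => (-1 : ℚ) ^ L.length • f L (u :: R))
        (fun R => (h₁ (u :: R)).smul_length) (fun L => ((h₂ L).cons u).const_smul _)
      simp only [List.cons_append, Bessel.unshuffleSum]
      rw [add_add_add_comm, i₁, i₂, add_zero]
  flip l₁ l₂ A B := by
    induction l₁ generalizing f with
    | nil =>
      simp only [List.nil_append, Bessel.unshuffleSum, unshuffleSum_add]
      refine (unshuffleSum_congr fun L R _ _ => ?_).trans (unshuffleSum_zero l₂)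
      have e₁ := eq_neg_of_add_eq_zero_left ((h₁ R).flip [] L A B)
      have e₂ := eq_neg_of_add_eq_zero_left ((h₂ L).flip [] R A B)
      simp only [List.nil_append] at e₁ e₂
      rw [e₁, e₂, smul_neg]
      abel
    | cons u l₁ ih =>
      have i₁ := ih (f := fun L R => f (u :: L) R) (fun R => (h₁ R).cons u) (fun L => h₂ (u :: L))
      have i₂ := ih (f := fun L R => (-1 : ℚ) ^ L.length • f L (u :: R))
        (fun R => (h₁ (u :: R)).smul_length) (fun L => ((h₂ L).cons u).const_smul _)
      simp only [List.cons_append, Bessel.unshuffleSum]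
      rw [add_add_add_comm, i₁, i₂, add_zero]

end Unshuffle

/-! ### Sums over refinements of a list -/

/-- The oriented vertices of `l'` arise from those of `l` by shrinking the sets of leaves. -/
def Refines (l' l : List (Finset α × Finset α)) : Prop :=
  List.Forall₂ (fun v' v => v'.1 ⊆ v.1 ∧ v'.2 ⊆ v.2) l' l

theorem Refines.exists_mem {l l' : List (Finset α × Finset α)} (h : Refines l' l)
    {v : Finset α × Finset α} (hv : v ∈ l') : ∃ w ∈ l, v.1 ⊆ w.1 ∧ v.2 ⊆ w.2 := by
  induction h with
  | nil => simp at hv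
  | @cons a b _ _ hab _ ih =>
    rcases List.mem_cons.1 hv with rfl | hv
    · exact ⟨b, by simp, hab⟩
    · obtain ⟨w, hw, h⟩ := ih hv
      exact ⟨w, by simp [hw], h⟩

/-- The sum of `f l'` over all `l'` obtained from a list by replacing every vertex `(A, B)` by some
`(a, b)` with `a ⊆ A` and `b ⊆ B`. -/
def refineSum : (List (Finset α × Finset α) → M) → List (Finset α × Finset α) → M
  | f, [] => f []
  | f, v :: l => ∑ a ∈ v.1.powerset, ∑ b ∈ v.2.powerset, refineSum (fun l' => f ((a, b) :: l')) l

theorem refineSum_congr {f g : List (Finset α × Finset α) → M} {l : List (Finset α × Finset α)}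
    (h : ∀ l', Refines l' l → f l' = g l') : refineSum f l = refineSum g l := by
  induction l generalizing f g with
  | nil => exact h [] .nil
  | cons v l ih =>
    rw [refineSum, refineSum]
    refine Finset.sum_congr rfl fun a ha => Finset.sum_congr rfl fun b hb => ?_
    exact ih fun l' hl' => h _ (.cons ⟨Finset.mem_powerset.1 ha, Finset.mem_powerset.1 hb⟩ hl')

theorem refineSum_mem [Module ℚ M] {p : Submodule ℚ M} {f : List (Finset α × Finset α) → M}
    {l : List (Finset α × Finset α)} (h : ∀ l', Refines l' l → f l' ∈ p) :
    refineSum f l ∈ p := by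
  induction l generalizing f with
  | nil => exact h [] .nil
  | cons v l ih =>
    rw [refineSum]
    refine p.sum_mem fun a ha => p.sum_mem fun b hb => ?_
    exact ih fun l' hl' => h _ (.cons ⟨Finset.mem_powerset.1 ha, Finset.mem_powerset.1 hb⟩ hl')

theorem map_refineSum [Module ℚ M] [Module ℚ N] (g : M →ₗ[ℚ] N) (f : List (Finset α × Finset α) → M)
    (l : List (Finset α × Finset α)) :
    g (refineSum f l) = refineSum (fun l' => g (f l')) l := by
  induction l generalizing f with
  | nil => rfl
  | cons v l ih => simp only [refineSum, map_sum, ih]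

theorem refineSum_add (f g : List (Finset α × Finset α) → M) (l : List (Finset α × Finset α)) :
    refineSum f l + refineSum g l = refineSum (fun l' => f l' + g l') l := by
  induction l generalizing f g with
  | nil => rfl
  | cons v l ih => simp only [refineSum, ← ih, Finset.sum_add_distrib]

theorem refineSum_zero (l : List (Finset α × Finset α)) :
    refineSum (fun _ => (0 : M)) l = 0 := by
  induction l with
  | nil => rfl
  | cons v l ih => simp [refineSum, ih]

theorem sum_refineSum {ι : Type*} (s : Finset ι) (f : ι → List (Finset α × Finset α) → M)
    (l : List (Finset α × Finset α)) :
    ∑ i ∈ s, refineSum (f i) l = refineSum (fun l' => ∑ i ∈ s, f i l') l := by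
  classical
  induction s using Finset.induction_on with
  | empty => simp [refineSum_zero]
  | insert i s hi ih => simp only [Finset.sum_insert hi, ih, refineSum_add]

theorem refineSum_append (f : List (Finset α × Finset α) → M)
    (l l' : List (Finset α × Finset α)) :
    refineSum f (l ++ l') = refineSum (fun k => refineSum (fun k' => f (k ++ k')) l') l := by
  induction l generalizing f with
  | nil => rfl
  | cons v l ih => simp only [List.cons_append, refineSum, ih]

theorem sum_comm₄ {ι κ : Type*} (s t : Finset ι) (u v : Finset κ) (f : ι → ι → κ → κ → M) :
    ∑ a ∈ s, ∑ b ∈ t, ∑ c ∈ u, ∑ d ∈ v, f a b c d =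
      ∑ c ∈ u, ∑ d ∈ v, ∑ a ∈ s, ∑ b ∈ t, f a b c d := by
  have := Finset.sum_comm (s := s ×ˢ t) (t := u ×ˢ v) (f := fun p q => f p.1 p.2 q.1 q.2)
  simpa only [Finset.sum_product] using this

/-- The choices made at different vertices, and at the two edges of one vertex, are independent;
after interchanging sums the terms cancel choice by choice. -/
theorem IsAlt.refineSum {f : List (Finset α × Finset α) → M} (hf : IsAlt f) :
    IsAlt (refineSum f) where
  swap l₁ l₂ v w := by
    induction l₁ generalizing f with
    | nil =>
      simp only [List.nil_append, Bessel.refineSum]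
      rw [sum_comm₄ w.1.powerset]
      simp only [← Finset.sum_add_distrib, refineSum_add]
      refine Finset.sum_eq_zero fun a _ => Finset.sum_eq_zero fun b _ =>
        Finset.sum_eq_zero fun c _ => Finset.sum_eq_zero fun d _ => ?_
      refine (refineSum_congr fun l' _ => ?_).trans (refineSum_zero l₂)
      exact hf.swap [] l' (a, b) (c, d)
    | cons u l₁ ih =>
      simp only [List.cons_append, Bessel.refineSum, ← Finset.sum_add_distrib]
      exact Finset.sum_eq_zero fun a _ => Finset.sum_eq_zero fun b _ => ih (hf.cons _)
  flip l₁ l₂ A B := by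
    induction l₁ generalizing f with
    | nil =>
      simp only [List.nil_append, Bessel.refineSum]
      rw [Finset.sum_comm (s := B.powerset)]
      simp only [← Finset.sum_add_distrib, refineSum_add]
      refine Finset.sum_eq_zero fun a _ => Finset.sum_eq_zero fun b _ => ?_
      refine (refineSum_congr fun l' _ => ?_).trans (refineSum_zero l₂)
      exact hf.flip [] l' a b
    | cons u l₁ ih =>
      simp only [List.cons_append, Bessel.refineSum, ← Finset.sum_add_distrib]
      exact Finset.sum_eq_zero fun a _ => Finset.sum_eq_zero fun b _ => ih (hf.cons _)

end Lists

end Bessel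

namespace Bessel

/-! ### Lists of oriented vertices as elements of `Bess(S)` -/

section ListClass

variable {α : Type*} [DecidableEq α] {S T : Finset α}

/-- The list of oriented vertices `l` is the list of vertices of an inner-oriented forest. -/
def IsForestList (S : Finset α) (l : List (Finset α × Finset α)) : Prop :=
  (l.map (fun v => s(v.1, v.2))).Nodup ∧ IsForest S (l.map (fun v => s(v.1, v.2))).toFinset

open Classical in
/-- The class of a list of oriented vertices, which is zero if they do not form a forest. -/
noncomputable def listCls (S : Finset α) (l : List (Finset α × Finset α)) : Bess S :=
  if h : IsForestList S l then cls ⟨l, h.1, h.2⟩ else 0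

theorem listCls_vertices (F : OrientedForest S) : listCls S F.vertices = cls F :=
  dif_pos (show IsForestList S F.vertices from ⟨F.nodup, F.isForest⟩)

theorem listCls_of_not {l : List (Finset α × Finset α)} (h : ¬ IsForestList S l) :
    listCls S l = 0 :=
  dif_neg h

theorem IsForestList.exists_vertices_eq {l : List (Finset α × Finset α)} (h : IsForestList S l) :
    ∃ F : OrientedForest S, F.vertices = l :=
  ⟨⟨l, h.1, h.2⟩, rfl⟩

theorem isForestList_congr {l l' : List (Finset α × Finset α)}
    (h : (l.map (fun v => s(v.1, v.2))).Perm (l'.map (fun v => s(v.1, v.2)))) :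
    IsForestList S l ↔ IsForestList S l' := by
  rw [IsForestList, IsForestList, h.nodup_iff, List.toFinset_eq_of_perm _ _ h]

theorem isAlt_listCls (S : Finset α) : IsAlt (listCls S) where
  swap l₁ l₂ v w := by
    have e : IsForestList S (l₁ ++ v :: w :: l₂) ↔ IsForestList S (l₁ ++ w :: v :: l₂) :=
      isForestList_congr (((List.Perm.swap w v l₂).append_left l₁).map _)
    by_cases h : IsForestList S (l₁ ++ v :: w :: l₂)
    · obtain ⟨F, hF⟩ := h.exists_vertices_eq
      obtain ⟨G, hG⟩ := (e.1 h).exists_vertices_eq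
      rw [← hF, ← hG, listCls_vertices, listCls_vertices]
      exact cls_add_cls (.swap l₁ l₂ v w hF hG)
    · rw [listCls_of_not h, listCls_of_not (mt e.2 h), add_zero]
  flip l₁ l₂ A B := by
    have e : IsForestList S (l₁ ++ (A, B) :: l₂) ↔ IsForestList S (l₁ ++ (B, A) :: l₂) :=
      isForestList_congr (by simp [Sym2.eq_swap (a := A)])
    by_cases h : IsForestList S (l₁ ++ (A, B) :: l₂)
    · obtain ⟨F, hF⟩ := h.exists_vertices_eq
      obtain ⟨G, hG⟩ := (e.1 h).exists_vertices_eq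
      rw [← hF, ← hG, listCls_vertices, listCls_vertices]
      exact cls_add_cls (.flip l₁ l₂ A B hF hG)
    · rw [listCls_of_not h, listCls_of_not (mt e.2 h), add_zero]

/-- Two inner-oriented forests with the same underlying forest agree up to sign. -/
theorem cls_eq_or_eq_neg {F G : OrientedForest S} (h : F.vertexSet = G.vertexSet) :
    cls F = cls G ∨ cls F = -cls G := by
  rw [← listCls_vertices, ← listCls_vertices]
  exact (isAlt_listCls S).eq_or_eq_neg
    (List.perm_of_nodup_nodup_toFinset_eq F.nodup G.nodup h)

theorem IsForest.exists_vertexSet_eq {V : Finset (Sym2 (Finset α))} (h : IsForest S V) :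
    ∃ F : OrientedForest S, F.vertexSet = V := by
  have e : (V.toList.map Quot.out).map (fun v => s(v.1, v.2)) = V.toList := by
    rw [List.map_map]
    exact (List.map_congr_left fun v _ => Quot.out_eq v).trans (List.map_id _)
  refine ⟨⟨V.toList.map Quot.out, ?_, ?_⟩, ?_⟩
  · rw [e]
    exact V.nodup_toList
  · rwa [e, Finset.toList_toFinset]
  · rw [OrientedForest.vertexSet, e, Finset.toList_toFinset]

/-- All vertices of the list lie in `S`. -/
def SupportedIn (S : Finset α) (l : List (Finset α × Finset α)) : Prop :=
  ∀ v ∈ l, v.1 ∪ v.2 ⊆ S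

theorem OrientedForest.supportedIn (F : OrientedForest S) : SupportedIn S F.vertices :=
  fun v hv => (F.isForest.vertex s(v.1, v.2)
    (List.mem_toFinset.2 (List.mem_map.2 ⟨v, hv, rfl⟩))).1

theorem SupportedIn.sublist {l l' : List (Finset α × Finset α)} (h : SupportedIn S l)
    (hl : l'.Sublist l) : SupportedIn S l' :=
  fun v hv => h v (hl.subset hv)

theorem SupportedIn.refines {l l' : List (Finset α × Finset α)} (h : SupportedIn S l)
    (hl : Refines l' l) : SupportedIn S l' := by
  intro v hv
  obtain ⟨w, hw, h₁, h₂⟩ := hl.exists_mem hv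
  exact (Finset.union_subset_union h₁ h₂).trans (h w hw)

/-- Among the vertices of the joint forest, those with leaves in `S` are exactly those of `l`, so
`IsForest.restrict` recovers the forest on `S`. -/
theorem IsForestList.of_append {l m : List (Finset α × Finset α)} (hd : Disjoint S T)
    (hS : S.Nonempty) (hl : SupportedIn S l) (hm : SupportedIn T m)
    (h : IsForestList (S ∪ T) (l ++ m)) : IsForestList S l := by
  have hl' : ∀ v ∈ (l.map (fun v => s(v.1, v.2))).toFinset, vertexLeaves v ⊆ S := by
    intro v hv
    obtain ⟨w, hw, rfl⟩ := List.mem_map.1 (List.mem_toFinset.1 hv)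
    exact hl w hw
  have hm' : ∀ v ∈ (m.map (fun v => s(v.1, v.2))).toFinset, vertexLeaves v ⊆ T := by
    intro v hv
    obtain ⟨w, hw, rfl⟩ := List.mem_map.1 (List.mem_toFinset.1 hv)
    exact hm w hw
  obtain ⟨hn, hf⟩ := h
  rw [List.map_append] at hn hf
  refine ⟨(List.nodup_append'.1 hn).1, ?_⟩
  rw [List.toFinset_append] at hf
  have := hf.restrict hS Finset.subset_union_left (by
    intro v hv
    rcases Finset.mem_union.1 hv with hv | hv
    · exact Or.inl (hl' v hv)
    · exact Or.inr (hd.symm.mono_left (hm' v hv)))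
  rwa [Finset.filter_union, Finset.filter_true_of_mem hl', Finset.filter_false_of_mem,
    Finset.union_empty] at this
  intro v hv hvS
  obtain ⟨x, hx⟩ := hf.vertexLeaves_nonempty (Finset.mem_union_right _ hv)
  exact Finset.disjoint_left.1 hd (hvS hx) (hm' v hv hx)

theorem isForestList_append_iff {l m : List (Finset α × Finset α)} (hd : Disjoint S T)
    (hS : S.Nonempty) (hT : T.Nonempty) (hl : SupportedIn S l) (hm : SupportedIn T m) :
    IsForestList (S ∪ T) (l ++ m) ↔ IsForestList S l ∧ IsForestList T m := by
  refine ⟨fun h => ⟨h.of_append hd hS hl hm, ?_⟩, fun ⟨h₁, h₂⟩ => ?_⟩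
  · refine IsForestList.of_append hd.symm hT hm hl ?_
    rw [Finset.union_comm]
    exact (isForestList_congr (List.perm_append_comm.map _)).1 h
  · let H := OrientedForest.disjointUnion hd ⟨l, h₁.1, h₁.2⟩ ⟨m, h₂.1, h₂.2⟩
    exact ⟨H.nodup, H.isForest⟩

/-! ### The operations `E` and `Ω` on lists of vertices -/

theorem compE_cls (h : Disjoint S T) (F : OrientedForest S) (G : OrientedForest T) :
    compE h (cls F) (cls G) = cls (F.disjointUnion h G) := by
  rw [compE, liftBess_cls, liftBess_cls]

theorem compOmega_cls (h : Disjoint S T) (F : OrientedForest S) (G : OrientedForest T) :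
    compOmega h (cls F) (cls G) = graftSum h F G := by
  rw [compOmega, liftBess_cls, liftBess_cls]

/-- The default value zero is respected too: the concatenation is a forest list only if both parts
are. -/
theorem listCls_append {l m : List (Finset α × Finset α)} (hd : Disjoint S T)
    (hS : S.Nonempty) (hT : T.Nonempty) (hl : SupportedIn S l) (hm : SupportedIn T m) :
    listCls (S ∪ T) (l ++ m) = compE hd (listCls S l) (listCls T m) := by
  have e := isForestList_append_iff hd hS hT hl hm
  by_cases h₁ : IsForestList S l
  · by_cases h₂ : IsForestList T m
    · obtain ⟨F, rfl⟩ := h₁.exists_vertices_eq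
      obtain ⟨G, rfl⟩ := h₂.exists_vertices_eq
      rw [listCls_vertices, listCls_vertices, compE_cls, ← listCls_vertices]
      rfl
    · rw [listCls_of_not h₂, listCls_of_not fun h => h₂ (e.1 h).2, map_zero]
  · rw [listCls_of_not h₁, listCls_of_not fun h => h₁ (e.1 h).1, map_zero, LinearMap.zero_apply]

theorem isForestList_cons_append {l m : List (Finset α × Finset α)} (hd : Disjoint S T)
    (hS : S.Nonempty) (hT : T.Nonempty) (hl : SupportedIn S l) (hm : SupportedIn T m)
    {a b : Finset α} (ha : a ⊆ S) (hb : b ⊆ T) (h : IsForestList (S ∪ T) ((a, b) :: (l ++ m))) :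
    IsForestList S l ∧ IsForestList T m ∧ a ∈ roots S (l.map (fun v => s(v.1, v.2))).toFinset ∧
      b ∈ roots T (m.map (fun v => s(v.1, v.2))).toFinset := by
  obtain ⟨hn, hf⟩ := h
  rw [List.map_cons] at hn hf
  rw [List.toFinset_cons] at hf
  obtain ⟨hn₁, hn₂⟩ := List.nodup_cons.1 hn
  have hv := hf.vertex _ (Finset.mem_insert_self _ _)
  obtain ⟨x, hx⟩ := (hv.2 a (Sym2.mem_mk_left _ _)).1
  obtain ⟨y, hy⟩ := (hv.2 b (Sym2.mem_mk_right _ _)).1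
  -- The set `a ∪ b` meets both `S` and `T`, whereas every other vertex has its leaves in one of
  -- them. So nothing lies below `(a, b)` and it can be removed.
  have key := hf.erase_root (Finset.mem_insert_self _ _) (by
    intro v hv' hm'
    rcases Finset.mem_insert.1 hv' with rfl | hv'
    · exact (hv.2 _ hm').2.ne rfl
    · obtain ⟨w, hw, rfl⟩ := List.mem_map.1 (List.mem_toFinset.1 hv')
      have hs := vertexLeaves_subset_of_mem hm'
      rcases List.mem_append.1 hw with hw | hw
      · exact Finset.disjoint_left.1 hd (hl w hw (hs (Finset.mem_union_right _ hy))) (hb hy)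
      · exact Finset.disjoint_left.1 hd (ha hx) (hm w hw (hs (Finset.mem_union_left _ hx))))
  rw [Finset.erase_insert (by rwa [List.mem_toFinset])] at key
  obtain ⟨h₁, h₂⟩ := (isForestList_append_iff hd hS hT hl hm).1 ⟨hn₂, key.1⟩
  rw [List.map_append, List.toFinset_append, roots_union h₁.2 h₂.2 hd] at key
  refine ⟨h₁, h₂, (Finset.mem_union.1 key.2.1).resolve_right fun h => ?_,
    (Finset.mem_union.1 key.2.2).resolve_left fun h => ?_⟩
  · exact Finset.disjoint_left.1 hd (ha hx) ((h₂.2.of_mem_roots h).2 hx)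
  · exact Finset.disjoint_left.1 hd ((h₁.2.of_mem_roots h).2 hy) (hb hy)

/-- Every vertex of the list lies in a tree of the forest `F`. -/
def SupportedInTrees (F : OrientedForest S) (l : List (Finset α × Finset α)) : Prop :=
  ∀ v ∈ l, ∃ r ∈ F.trees, v.1 ∪ v.2 ⊆ r

theorem OrientedForest.supportedInTrees (F : OrientedForest S) :
    SupportedInTrees F F.vertices :=
  fun v hv => F.isForest.exists_root_of_vertex (v := s(v.1, v.2))
    (List.mem_toFinset.2 (List.mem_map.2 ⟨v, hv, rfl⟩))

theorem OrientedForest.subset_of_mem_trees (F : OrientedForest S) {r : Finset α}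
    (hr : r ∈ F.trees) : r ⊆ S :=
  (F.isForest.of_mem_roots hr).2

variable {F : OrientedForest S} {G : OrientedForest T} {l m : List (Finset α × Finset α)}

theorem SupportedInTrees.supportedIn (h : SupportedInTrees F l) : SupportedIn S l := by
  intro v hv
  obtain ⟨r, hr, hvr⟩ := h v hv
  exact hvr.trans (F.subset_of_mem_trees hr)

theorem SupportedInTrees.sublist {l' : List (Finset α × Finset α)} (h : SupportedInTrees F l)
    (hl : l'.Sublist l) : SupportedInTrees F l' :=
  fun v hv => h v (hl.subset hv)

theorem SupportedInTrees.refines {l' : List (Finset α × Finset α)} (h : SupportedInTrees F l)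
    (hl : Refines l' l) : SupportedInTrees F l' := by
  intro v hv
  obtain ⟨w, hw, h₁, h₂⟩ := hl.exists_mem hv
  obtain ⟨r, hr, hwr⟩ := h w hw
  exact ⟨r, hr, (Finset.union_subset_union h₁ h₂).trans hwr⟩

/-- If the vertices of the forest `F'` lie in trees of `F`, every tree of `F'` lies in exactly one
tree of `F`. -/
theorem sum_powerset_trees {M : Type*} [AddCommGroup M] {F F' : OrientedForest S}
    (hF : SupportedInTrees F F'.vertices) (f : Finset α → M)
    (hf : ∀ a ⊆ S, a ∉ F'.trees → f a = 0) :
    ∑ r ∈ F.trees, ∑ a ∈ r.powerset, f a = ∑ a ∈ F'.trees, f a := by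
  have h₁ : ∀ r ∈ F.trees, ∑ a ∈ r.powerset, f a = ∑ a ∈ F'.trees with a ⊆ r, f a := by
    intro r hr
    symm
    refine Finset.sum_subset (fun a ha => Finset.mem_powerset.2 (Finset.mem_filter.1 ha).2) ?_
    intro a ha ha'
    have har := Finset.mem_powerset.1 ha
    exact hf a (har.trans (F.subset_of_mem_trees hr))
      fun h => ha' (Finset.mem_filter.2 ⟨h, har⟩)
  rw [Finset.sum_congr rfl h₁]
  simp only [Finset.sum_filter]
  rw [Finset.sum_comm]
  refine Finset.sum_congr rfl fun a ha => ?_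
  -- A tree of `F'` is either a single leaf or the leaf set of a vertex of `F'`; both lie in some
  -- tree of `F`, and disjointness of trees makes it unique.
  obtain ⟨r, hr, har⟩ : ∃ r ∈ F.trees, a ⊆ r := by
    rcases (mem_roots.1 ha).1 with ⟨x, hx, rfl⟩ | ⟨v, hv, rfl⟩
    · obtain ⟨r, hr, hxr⟩ := F.isForest.exists_root_of_mem hx
      exact ⟨r, hr, Finset.singleton_subset_iff.2 hxr⟩
    · obtain ⟨w, hw, rfl⟩ := List.mem_map.1 (List.mem_toFinset.1 hv)
      exact hF w hw
  rw [Finset.sum_eq_single_of_mem r hr, if_pos har]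
  intro s hs hsr
  refine if_neg fun has => ?_
  obtain ⟨x, hx⟩ := (F'.isForest.of_mem_roots ha).1
  exact Finset.disjoint_left.1 (F.isForest.roots_pairwiseDisjoint s hs r hr hsr) (has hx) (har hx)

/-- A summand is nonzero only if `l` and `m` form forests and `a`, `b` are trees of them. Every such
pair lies in exactly one pair `(r, s)` by `sum_powerset_trees`, so each graft is counted once. -/
theorem sum_listCls_graft (hd : Disjoint S T) (hl : SupportedInTrees F l)
    (hm : SupportedInTrees G m) :
    ∑ r ∈ F.trees, ∑ s ∈ G.trees, ∑ a ∈ r.powerset, ∑ b ∈ s.powerset,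
      listCls (S ∪ T) ((a, b) :: (l ++ m)) = compOmega hd (listCls S l) (listCls T m) := by
  have hS := F.isForest.nonempty
  have hT := G.isForest.nonempty
  have key := fun a b ha hb => isForestList_cons_append (a := a) (b := b) hd hS hT
    hl.supportedIn hm.supportedIn ha hb
  have zero : ¬ (IsForestList S l ∧ IsForestList T m) →
      ∑ r ∈ F.trees, ∑ s ∈ G.trees, ∑ a ∈ r.powerset, ∑ b ∈ s.powerset,
      listCls (S ∪ T) ((a, b) :: (l ++ m)) = 0 := by
    intro hn
    refine Finset.sum_eq_zero fun r hr => Finset.sum_eq_zero fun s hs =>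
      Finset.sum_eq_zero fun a ha => Finset.sum_eq_zero fun b hb => listCls_of_not fun h => hn ?_
    have := key a b ((Finset.mem_powerset.1 ha).trans (F.subset_of_mem_trees hr))
      ((Finset.mem_powerset.1 hb).trans (G.subset_of_mem_trees hs)) h
    exact ⟨this.1, this.2.1⟩
  by_cases h₁ : IsForestList S l
  · by_cases h₂ : IsForestList T m
    · obtain ⟨F', rfl⟩ := h₁.exists_vertices_eq
      obtain ⟨G', rfl⟩ := h₂.exists_vertices_eq
      rw [listCls_vertices, listCls_vertices, compOmega_cls, graftSum]
      have e : ∀ r ∈ F'.trees.attach, ∀ s ∈ G'.trees.attach, cls (F'.graft hd G' r.2 s.2) =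
          listCls (S ∪ T) ((r.1, s.1) :: (F'.vertices ++ G'.vertices)) :=
        fun r _ s _ => (listCls_vertices (F'.graft hd G' r.2 s.2)).symm
      rw [Finset.sum_congr rfl fun r hr => Finset.sum_congr rfl (e r hr),
        Finset.sum_attach F'.trees (fun r => ∑ s ∈ G'.trees.attach,
          listCls (S ∪ T) ((r, s.1) :: (F'.vertices ++ G'.vertices)))]
      rw [Finset.sum_congr rfl fun r _ => Finset.sum_attach G'.trees (fun s =>
          listCls (S ∪ T) ((r, s) :: (F'.vertices ++ G'.vertices))), ← sum_powerset_trees hl]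
      · refine Finset.sum_congr rfl fun r hr => ?_
        rw [Finset.sum_comm]
        refine Finset.sum_congr rfl fun a ha => ?_
        refine sum_powerset_trees hm _ fun b hb hb' => listCls_of_not fun h => hb' ?_
        exact (key a b ((Finset.mem_powerset.1 ha).trans (F.subset_of_mem_trees hr)) hb h).2.2.2
      · intro a ha ha'
        refine Finset.sum_eq_zero fun b hb => listCls_of_not fun h => ha' ?_
        exact (key a b ha (G'.subset_of_mem_trees hb) h).2.2.1
    · rw [zero (fun h => h₂ h.2), listCls_of_not h₂, map_zero]
  · rw [zero (fun h => h₁ h.1), listCls_of_not h₁, map_zero, LinearMap.zero_apply]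

/-! ### Sums over refinements in `Bess(S)` -/

/-- The sum of the classes of all forests which refine the given list of oriented vertices. -/
noncomputable def refineCls (S : Finset α) (l : List (Finset α × Finset α)) : Bess S :=
  refineSum (listCls S) l

theorem isAlt_refineCls (S : Finset α) : IsAlt (refineCls S) :=
  (isAlt_listCls S).refineSum

theorem listCls_mem_component (S : Finset α) (l : List (Finset α × Finset α)) :
    listCls S l ∈ component S l.length := by
  by_cases h : IsForestList S l
  · obtain ⟨F, rfl⟩ := h.exists_vertices_eq
    rw [listCls_vertices]
    exact Submodule.subset_span ⟨F, rfl, rfl⟩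
  · rw [listCls_of_not h]
    exact Submodule.zero_mem _

theorem refineCls_mem_component (S : Finset α) (l : List (Finset α × Finset α)) :
    refineCls S l ∈ component S l.length :=
  refineSum_mem fun l' hl' => by
    rw [← hl'.length_eq]
    exact listCls_mem_component S l'

theorem refineCls_append (hd : Disjoint S T) (hS : S.Nonempty) (hT : T.Nonempty)
    (hl : SupportedIn S l) (hm : SupportedIn T m) :
    refineCls (S ∪ T) (l ++ m) = compE hd (refineCls S l) (refineCls T m) := by
  rw [refineCls, refineSum_append, refineCls, refineCls, ← LinearMap.flip_apply, map_refineSum]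
  refine refineSum_congr fun l' hl' => ?_
  rw [LinearMap.flip_apply, map_refineSum]
  exact refineSum_congr fun m' hm' => listCls_append hd hS hT (hl.refines hl') (hm.refines hm')

/-- This is why the new vertex has to be refined as well: the left side starts from trees of `F` and
`G`, while `compOmega` on the right joins the smaller trees of the forests that refine `l` and `m`.
-/
theorem sum_refineCls_graft (hd : Disjoint S T) (hl : SupportedInTrees F l)
    (hm : SupportedInTrees G m) :
    ∑ r ∈ F.trees, ∑ s ∈ G.trees, refineCls (S ∪ T) ((r, s) :: (l ++ m)) =
      compOmega hd (refineCls S l) (refineCls T m) := by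
  simp only [refineCls, refineSum, sum_refineSum, refineSum_append]
  rw [← LinearMap.flip_apply, map_refineSum]
  refine refineSum_congr fun l' hl' => ?_
  rw [LinearMap.flip_apply, map_refineSum]
  exact refineSum_congr fun m' hm' => sum_listCls_graft hd (hl.refines hl') (hm.refines hm')

end ListClass

end Bessel

namespace Bessel

section Coproduct

variable {α : Type*} [DecidableEq α] {S T : Finset α}

/-! ### Homogeneous elements and the Koszul sign -/

theorem projEnd_cls (F : OrientedForest S) (n : ℕ) :
    projEnd S n (cls F) = if F.vertices.length = n then cls F else 0 := by
  rw [projEnd, LinearMap.comp_apply, proj, liftBess_cls]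
  split_ifs <;> rfl

theorem OrientedForest.length_lt (F : OrientedForest S) : F.vertices.length < S.card := by
  have := F.isForest.card_lt
  rwa [List.toFinset_card_of_nodup F.nodup, List.length_map] at this

theorem parity_of_mem {n : ℕ} {x : Bess S} (hx : x ∈ component S n) :
    parity S x = (-1 : ℚ) ^ n • x := by
  induction hx using Submodule.span_induction with
  | mem x h =>
    obtain ⟨F, rfl, rfl⟩ := h
    simp only [parity, LinearMap.sum_apply, LinearMap.smul_apply, projEnd_cls, smul_ite, smul_zero]
    rw [Finset.sum_ite_eq, if_pos (Finset.mem_range.2 (F.length_lt.trans (Nat.lt_succ_self _)))]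
  | zero => simp
  | add x y _ _ hx hy => rw [map_add, hx, hy, smul_add]
  | smul c x _ hx => rw [map_smul, hx, smul_comm]

theorem koszul_of_mem {p q : ℕ} {x₂ : Bess S} {y₁ : Bess T} (hx : x₂ ∈ component S p)
    (hy : y₁ ∈ component T q) (x₁ : Bess S) (y₂ : Bess T) :
    koszul S T ((x₁ ⊗ₜ[ℚ] x₂) ⊗ₜ[ℚ] (y₁ ⊗ₜ[ℚ] y₂)) =
      (-1 : ℚ) ^ (p * q) • ((x₁ ⊗ₜ[ℚ] y₁) ⊗ₜ[ℚ] (x₂ ⊗ₜ[ℚ] y₂)) := by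
  induction hx using Submodule.span_induction with
  | mem x h =>
    obtain ⟨F, rfl, rfl⟩ := h
    induction hy using Submodule.span_induction with
    | mem y h =>
      obtain ⟨G, rfl, rfl⟩ := h
      simp only [koszul, LinearMap.sum_apply, LinearMap.smul_apply, LinearMap.comp_apply,
        TensorProduct.map_tmul, projEnd_cls, LinearMap.id_apply, LinearEquiv.coe_coe,
        TensorProduct.tensorTensorTensorComm_tmul]
      rw [Finset.sum_eq_single_of_mem F.vertices.length
        (Finset.mem_range.2 (F.length_lt.trans (Nat.lt_succ_self _))),
        Finset.sum_eq_single_of_mem G.vertices.length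
        (Finset.mem_range.2 (G.length_lt.trans (Nat.lt_succ_self _))), if_pos rfl, if_pos rfl]
      · intro b _ hb
        rw [if_neg hb.symm]
        simp
      · intro b _ hb
        rw [if_neg hb.symm]
        simp
    | zero => simp
    | add x y _ _ hx hy => simp only [TensorProduct.add_tmul, TensorProduct.tmul_add, map_add,
        hx, hy, smul_add]
    | smul c x _ hx =>
      simp only [← TensorProduct.smul_tmul', TensorProduct.tmul_smul, map_smul, hx]
      rw [smul_comm]
  | zero => simp
  | add x y _ _ hx hy => simp only [TensorProduct.add_tmul, TensorProduct.tmul_add, map_add,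
      hx, hy, smul_add]
  | smul c x _ hx =>
    simp only [← TensorProduct.smul_tmul', TensorProduct.tmul_smul, map_smul, hx]
    rw [smul_comm]

/-- `compTensor` as a bilinear map. -/
noncomputable def compTensorBilin (μ ν : Bess S →ₗ[ℚ] Bess T →ₗ[ℚ] Bess (S ∪ T)) :
    Bess S ⊗[ℚ] Bess S →ₗ[ℚ] Bess T ⊗[ℚ] Bess T →ₗ[ℚ] Bess (S ∪ T) ⊗[ℚ] Bess (S ∪ T) :=
  (TensorProduct.mk ℚ _ _).compr₂
    (TensorProduct.map (TensorProduct.lift μ) (TensorProduct.lift ν) ∘ₗ koszul S T)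

theorem compTensorBilin_apply (μ ν : Bess S →ₗ[ℚ] Bess T →ₗ[ℚ] Bess (S ∪ T))
    (X : Bess S ⊗[ℚ] Bess S) (Y : Bess T ⊗[ℚ] Bess T) :
    compTensorBilin μ ν X Y = compTensor μ ν X Y :=
  rfl

theorem compTensor_tmul {p q : ℕ} {x₂ : Bess S} {y₁ : Bess T} (hx : x₂ ∈ component S p)
    (hy : y₁ ∈ component T q) (x₁ : Bess S) (y₂ : Bess T)
    (μ ν : Bess S →ₗ[ℚ] Bess T →ₗ[ℚ] Bess (S ∪ T)) :
    compTensor μ ν (x₁ ⊗ₜ[ℚ] x₂) (y₁ ⊗ₜ[ℚ] y₂) =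
      (-1 : ℚ) ^ (p * q) • (μ x₁ y₁ ⊗ₜ[ℚ] ν x₂ y₂) := by
  rw [compTensor, koszul_of_mem hx hy, map_smul, TensorProduct.map_tmul, TensorProduct.lift.tmul,
    TensorProduct.lift.tmul]

/-! ### The coproduct -/

/-- The coproduct on lists of oriented vertices. -/
noncomputable def listCoproduct (S : Finset α) (l : List (Finset α × Finset α)) :
    Bess S ⊗[ℚ] Bess S :=
  unshuffleSum (fun L R => refineCls S L ⊗ₜ[ℚ] refineCls S R) l

theorem isAlt_listCoproduct (S : Finset α) : IsAlt (listCoproduct S) :=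
  IsAlt.unshuffleSum
    (fun R => (isAlt_refineCls S).map ((TensorProduct.mk ℚ (Bess S) (Bess S)).flip (refineCls S R)))
    (fun L => (isAlt_refineCls S).map (TensorProduct.mk ℚ (Bess S) (Bess S) (refineCls S L)))

/-- An alternating function on lists of oriented vertices as a linear map on `Bess(S)`. -/
noncomputable def IsAlt.lift {M : Type*} [AddCommGroup M] [Module ℚ M]
    {f : List (Finset α × Finset α) → M} (hf : IsAlt f) (S : Finset α) : Bess S →ₗ[ℚ] M :=
  liftBess (fun F => f F.vertices) (by
    intro F G h
    cases h with
    | swap l₁ l₂ v w h₁ h₂ => rw [h₁, h₂, hf.swap]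
    | flip l₁ l₂ A B h₁ h₂ => rw [h₁, h₂, hf.flip])

theorem IsAlt.lift_cls {M : Type*} [AddCommGroup M] [Module ℚ M]
    {f : List (Finset α × Finset α) → M} (hf : IsAlt f) (F : OrientedForest S) :
    hf.lift S (cls F) = f F.vertices :=
  liftBess_cls _ _ F

/-- The coproduct of the Bessel operad. -/
noncomputable def coproduct (S : Finset α) : Bess S →ₗ[ℚ] Bess S ⊗[ℚ] Bess S :=
  (isAlt_listCoproduct S).lift S

theorem coproduct_cls (F : OrientedForest S) : coproduct S (cls F) = listCoproduct S F.vertices :=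
  IsAlt.lift_cls _ F

theorem coproduct_noVertex (hS : S.Nonempty) :
    coproduct S (cls (.noVertex hS)) = cls (.noVertex hS) ⊗ₜ[ℚ] cls (.noVertex hS) := by
  rw [coproduct_cls, ← listCls_vertices]
  rfl

theorem bilin_ext {M : Type*} [AddCommGroup M] [Module ℚ M]
    {f g : Bess S →ₗ[ℚ] Bess T →ₗ[ℚ] M} (h : ∀ F G, f (cls F) (cls G) = g (cls F) (cls G))
    (x : Bess S) (y : Bess T) : f x y = g x y := by
  have : f = g := hom_ext fun F => hom_ext fun G => h F G
  rw [this]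

theorem compTensor_listCoproduct (μ ν : Bess S →ₗ[ℚ] Bess T →ₗ[ℚ] Bess (S ∪ T))
    (l m : List (Finset α × Finset α)) :
    compTensor μ ν (listCoproduct S l) (listCoproduct T m) =
      unshuffleSum (fun L R => unshuffleSum (fun L' R' => (-1 : ℚ) ^ (R.length * L'.length) •
        (μ (refineCls S L) (refineCls T L') ⊗ₜ[ℚ] ν (refineCls S R) (refineCls T R'))) m) l := by
  rw [← compTensorBilin_apply, listCoproduct, listCoproduct, map_unshuffleSum₂]
  simp only [compTensorBilin_apply, compTensor_tmul (refineCls_mem_component S _)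
    (refineCls_mem_component T _)]

theorem map_parity_listCoproduct (l : List (Finset α × Finset α)) :
    TensorProduct.map (parity S) LinearMap.id (listCoproduct S l) =
      unshuffleSum (fun L R => ((-1 : ℚ) ^ L.length • refineCls S L) ⊗ₜ[ℚ] refineCls S R) l := by
  rw [listCoproduct, map_unshuffleSum]
  simp only [TensorProduct.map_tmul, parity_of_mem (refineCls_mem_component S _),
    LinearMap.id_apply]

theorem compTensorOdd_listCoproduct (μ ν : Bess S →ₗ[ℚ] Bess T →ₗ[ℚ] Bess (S ∪ T))
    (l m : List (Finset α × Finset α)) :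
    compTensorOdd μ ν (listCoproduct S l) (listCoproduct T m) =
      unshuffleSum (fun L R => unshuffleSum (fun L' R' => (-1 : ℚ) ^ (R.length * L'.length) •
        (-1 : ℚ) ^ (L.length + L'.length) •
        (μ (refineCls S L) (refineCls T L') ⊗ₜ[ℚ] ν (refineCls S R) (refineCls T R'))) m) l := by
  rw [compTensorOdd, map_parity_listCoproduct, map_parity_listCoproduct, ← compTensorBilin_apply,
    map_unshuffleSum₂]
  refine unshuffleSum_congr fun L R _ _ => unshuffleSum_congr fun L' R' _ _ => ?_
  rw [compTensorBilin_apply, compTensor_tmul (refineCls_mem_component S _)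
    (Submodule.smul_mem _ _ (refineCls_mem_component T _)), map_smul, map_smul,
    LinearMap.smul_apply, smul_smul, ← TensorProduct.smul_tmul', pow_add, mul_comm ((-1 : ℚ) ^ _)]

theorem coproduct_compE (h : Disjoint S T) (x : Bess S) (y : Bess T) :
    coproduct (S ∪ T) (compE h x y) =
      compTensor (compE h) (compE h) (coproduct S x) (coproduct T y) := by
  refine bilin_ext (f := (compE h).compr₂ (coproduct (S ∪ T)))
    (g := (compTensorBilin (compE h) (compE h)).compl₁₂ (coproduct S) (coproduct T)) ?_ x y
  intro F G
  simp only [LinearMap.compr₂_apply, LinearMap.compl₁₂_apply, compTensorBilin_apply, compE_cls,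
    coproduct_cls, compTensor_listCoproduct]
  rw [listCoproduct, OrientedForest.disjointUnion, unshuffleSum_append]
  refine unshuffleSum_congr fun L R hL hR => unshuffleSum_congr fun L' R' hL' hR' => ?_
  have hS := F.isForest.nonempty
  have hT := G.isForest.nonempty
  rw [refineCls_append h hS hT (F.supportedIn.sublist hL) (G.supportedIn.sublist hL'),
    refineCls_append h hS hT (F.supportedIn.sublist hR) (G.supportedIn.sublist hR')]

theorem map_graftSum {M : Type*} [AddCommGroup M] [Module ℚ M]
    {f : List (Finset α × Finset α) → M} (hf : IsAlt f) (h : Disjoint S T)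
    (F : OrientedForest S) (G : OrientedForest T) :
    hf.lift (S ∪ T) (graftSum h F G) =
      ∑ r ∈ F.trees, ∑ s ∈ G.trees, f ((r, s) :: (F.vertices ++ G.vertices)) := by
  simp only [graftSum, map_sum, IsAlt.lift_cls, OrientedForest.graft]
  rw [Finset.sum_attach F.trees (fun r => ∑ s ∈ G.trees.attach,
    f ((r, s.1) :: (F.vertices ++ G.vertices)))]
  exact Finset.sum_congr rfl fun r _ => Finset.sum_attach G.trees
    (fun s => f ((r, s) :: (F.vertices ++ G.vertices)))

/-- The new vertex heads the list. Sent to the right it crosses `L ++ L'`, which gives the sign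
`(-1) ^ (L.length + L'.length)` that `compTensorOdd` attaches to an odd operation; sent to the left
it crosses nothing. -/
theorem coproduct_compOmega (h : Disjoint S T) (x : Bess S) (y : Bess T) :
    coproduct (S ∪ T) (compOmega h x y) =
      compTensorOdd (compE h) (compOmega h) (coproduct S x) (coproduct T y) +
        compTensor (compOmega h) (compE h) (coproduct S x) (coproduct T y) := by
  refine bilin_ext (f := (compOmega h).compr₂ (coproduct (S ∪ T)))
    (g := (compTensorBilin (compE h) (compOmega h)).compl₁₂
      (TensorProduct.map (parity S) LinearMap.id ∘ₗ coproduct S)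
      (TensorProduct.map (parity T) LinearMap.id ∘ₗ coproduct T) +
      (compTensorBilin (compOmega h) (compE h)).compl₁₂ (coproduct S) (coproduct T)) ?_ x y
  intro F G
  have odd : ∀ X Y, compTensor (compE h) (compOmega h)
    (TensorProduct.map (parity S) LinearMap.id X) (TensorProduct.map (parity T) LinearMap.id Y) =
      compTensorOdd (compE h) (compOmega h) X Y := fun _ _ => rfl
  simp only [LinearMap.compr₂_apply, LinearMap.add_apply, LinearMap.compl₁₂_apply,
    LinearMap.comp_apply, compTensorBilin_apply, compOmega_cls, coproduct_cls, odd,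
    compTensor_listCoproduct, compTensorOdd_listCoproduct]
  rw [coproduct, map_graftSum]
  simp only [listCoproduct, unshuffleSum, Finset.sum_add_distrib, sum_unshuffleSum,
    unshuffleSum_append]
  -- `unshuffleSum` puts the case of a left-going vertex first, while the target starts with the odd
  -- term.
  rw [add_comm]
  have hS := F.isForest.nonempty
  have hT := G.isForest.nonempty
  congr 1
  · refine unshuffleSum_congr fun L R hL hR => unshuffleSum_congr fun L' R' hL' hR' => ?_
    rw [refineCls_append h hS hT (F.supportedIn.sublist hL) (G.supportedIn.sublist hL'),
      ← sum_refineCls_graft h (F.supportedInTrees.sublist hR) (G.supportedInTrees.sublist hR'),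
      List.length_append]
    simp only [← Finset.smul_sum, ← TensorProduct.tmul_sum]
  · refine unshuffleSum_congr fun L R hL hR => unshuffleSum_congr fun L' R' hL' hR' => ?_
    rw [refineCls_append h hS hT (F.supportedIn.sublist hR) (G.supportedIn.sublist hR'),
      ← sum_refineCls_graft h (F.supportedInTrees.sublist hL) (G.supportedInTrees.sublist hL')]
    simp only [← Finset.smul_sum, ← TensorProduct.sum_tmul]

theorem isCoproduct_coproduct : IsCoproduct (coproduct (α := α)) where
  unit _ := coproduct_noVertex _
  compE _ _ := coproduct_compE
  compOmega _ _ := coproduct_compOmega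

/-! ### The operad is generated by `E` and `Ω` -/

theorem cls_mem_of_vertexSet_eq {p : Submodule ℚ (Bess S)} {F G : OrientedForest S}
    (h : F.vertexSet = G.vertexSet) (hG : cls G ∈ p) : cls F ∈ p := by
  rcases cls_eq_or_eq_neg h with e | e <;> rw [e]
  · exact hG
  · exact p.neg_mem hG

variable {p : ∀ S : Finset α, Submodule ℚ (Bess S)}

theorem IsTree.cls_mem
    (unit : ∀ a, cls (.noVertex (Finset.singleton_nonempty a)) ∈ p {a})
    (omega : ∀ (S T : Finset α) (h : Disjoint S T), ∀ x ∈ p S, ∀ y ∈ p T,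
      compOmega h x y ∈ p (S ∪ T))
    {V : Finset (Sym2 (Finset α))} (hV : IsTree S V) (F : OrientedForest S)
    (hF : F.vertexSet = V) : cls F ∈ p S := by
  induction hV with
  | leaf a => exact cls_mem_of_vertexSet_eq (hF.trans rfl) (unit a)
  | @graft S T V W hV hW hd h₁ h₂ =>
    obtain ⟨G, rfl⟩ := (IsForest.tree hV).exists_vertexSet_eq
    obtain ⟨H, rfl⟩ := (IsForest.tree hW).exists_vertexSet_eq
    have hG : S ∈ G.trees := hV.roots_eq.symm.subset (Finset.mem_singleton_self S)
    have hH : T ∈ H.trees := hW.roots_eq.symm.subset (Finset.mem_singleton_self T)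
    -- A tree has a single root, so the sum defining `Ω` reduces to one graft.
    have e : compOmega hd (cls G) (cls H) = cls (G.graft hd H hG hH) := by
      rw [compOmega_cls, graftSum,
        Finset.sum_eq_single_of_mem ⟨S, hG⟩ (Finset.mem_attach _ _),
        Finset.sum_eq_single_of_mem ⟨T, hH⟩ (Finset.mem_attach _ _)]
      · exact fun s _ hs => (hs (Subtype.ext (hW.eq_of_mem_roots s.2))).elim
      · exact fun r _ hr => (hr (Subtype.ext (hV.eq_of_mem_roots r.2))).elim
    refine cls_mem_of_vertexSet_eq (G := G.graft hd H hG hH) ?_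
      (e ▸ omega S T hd _ (h₁ G rfl) _ (h₂ H rfl))
    rw [hF]
    simp [OrientedForest.vertexSet, OrientedForest.graft]

theorem IsForest.cls_mem
    (unit : ∀ a, cls (.noVertex (Finset.singleton_nonempty a)) ∈ p {a})
    (disj : ∀ (S T : Finset α) (h : Disjoint S T), ∀ x ∈ p S, ∀ y ∈ p T, compE h x y ∈ p (S ∪ T))
    (omega : ∀ (S T : Finset α) (h : Disjoint S T), ∀ x ∈ p S, ∀ y ∈ p T,
      compOmega h x y ∈ p (S ∪ T))
    {V : Finset (Sym2 (Finset α))} (hV : IsForest S V) (F : OrientedForest S)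
    (hF : F.vertexSet = V) : cls F ∈ p S := by
  induction hV with
  | tree hV => exact hV.cls_mem unit omega F hF
  | @union S T V W hV hW hd h₁ h₂ =>
    obtain ⟨G, rfl⟩ := hV.exists_vertexSet_eq
    obtain ⟨H, rfl⟩ := hW.exists_vertexSet_eq
    refine cls_mem_of_vertexSet_eq (G := G.disjointUnion hd H) ?_
      (compE_cls hd G H ▸ disj S T hd _ (h₁ G rfl) _ (h₂ H rfl))
    rw [hF]
    simp [OrientedForest.vertexSet, OrientedForest.disjointUnion]

/-- Two families of linear maps on `Bess` agree if their equalizer contains the unit and is closed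
under the composition with the generators. -/
theorem family_ext {M : Finset α → Type*} [∀ S, AddCommGroup (M S)] [∀ S, Module ℚ (M S)]
    {f g : ∀ S : Finset α, Bess S →ₗ[ℚ] M S}
    (unit : ∀ a, f {a} (cls (.noVertex (Finset.singleton_nonempty a))) =
      g {a} (cls (.noVertex (Finset.singleton_nonempty a))))
    (disj : ∀ (S T : Finset α) (h : Disjoint S T) (x : Bess S) (y : Bess T), f S x = g S x →
      f T y = g T y → f (S ∪ T) (compE h x y) = g (S ∪ T) (compE h x y))
    (omega : ∀ (S T : Finset α) (h : Disjoint S T) (x : Bess S) (y : Bess T), f S x = g S x →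
      f T y = g T y → f (S ∪ T) (compOmega h x y) = g (S ∪ T) (compOmega h x y)) : f = g :=
  funext fun _ => hom_ext fun F => F.isForest.cls_mem (p := fun S => LinearMap.eqLocus (f S) (g S))
    unit (fun S T h x hx y hy => disj S T h x y hx hy)
    (fun S T h x hx y hy => omega S T h x y hx hy) F rfl

theorem IsCoproduct.unique {Δ Δ' : ∀ S : Finset α, Bess S →ₗ[ℚ] Bess S ⊗[ℚ] Bess S}
    (h : IsCoproduct Δ) (h' : IsCoproduct Δ') : Δ = Δ' :=
  family_ext (M := fun S => Bess S ⊗[ℚ] Bess S) (fun a => (h.unit a).trans (h'.unit a).symm)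
    (fun S T hd x y hx hy => by rw [h.compE, h'.compE, hx, hy])
    (fun S T hd x y hx hy => by rw [h.compOmega, h'.compOmega, hx, hy])

/-- A forest is the only forest on the same leaves which refines its vertices. -/
theorem refineCls_vertices (F : OrientedForest S) : refineCls S F.vertices = cls F := by
  -- Refinement induces a family of endomorphisms that fixes the unit and commutes with `E` and `Ω`,
  -- as the identity does; generation then forces equality without any direct analysis of
  -- refinements.
  have key : (fun S : Finset α => (isAlt_refineCls S).lift S) =
      fun S : Finset α => (LinearMap.id : Bess S →ₗ[ℚ] Bess S) := by
    refine family_ext (fun a => ?_) (fun S T h x y hx hy => ?_) (fun S T h x y hx hy => ?_)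
    · rw [IsAlt.lift_cls, LinearMap.id_apply, ← listCls_vertices]
      rfl
    · have := bilin_ext (f := (compE h).compr₂ ((isAlt_refineCls (S ∪ T)).lift (S ∪ T)))
        (g := (compE h).compl₁₂ ((isAlt_refineCls S).lift S) ((isAlt_refineCls T).lift T)) (by
          intro F G
          simp only [LinearMap.compr₂_apply, LinearMap.compl₁₂_apply, compE_cls, IsAlt.lift_cls]
          exact refineCls_append h F.isForest.nonempty G.isForest.nonempty F.supportedIn
            G.supportedIn) x y
      simp only [LinearMap.compr₂_apply, LinearMap.compl₁₂_apply, hx, hy] at this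
      exact this
    · have := bilin_ext (f := (compOmega h).compr₂ ((isAlt_refineCls (S ∪ T)).lift (S ∪ T)))
        (g := (compOmega h).compl₁₂ ((isAlt_refineCls S).lift S) ((isAlt_refineCls T).lift T)) (by
          intro F G
          simp only [LinearMap.compr₂_apply, LinearMap.compl₁₂_apply, compOmega_cls,
            IsAlt.lift_cls, map_graftSum]
          exact sum_refineCls_graft h F.supportedInTrees G.supportedInTrees) x y
      simp only [LinearMap.compr₂_apply, LinearMap.compl₁₂_apply, hx, hy] at this
      exact this
  have := LinearMap.congr_fun (congrFun key S) (cls F)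
  rwa [IsAlt.lift_cls] at this

/-! ### The component of degree zero and the counit -/

theorem OrientedForest.eq_noVertex (hS : S.Nonempty) {F : OrientedForest S}
    (hF : F.vertices.length = 0) : F = .noVertex hS :=
  OrientedForest.ext (List.length_eq_zero_iff.1 hF)

/-- The coefficient of the forest with no inner vertex. -/
noncomputable def counit (S : Finset α) : Bess S →ₗ[ℚ] ℚ :=
  liftBess (fun F => if F.vertices.length = 0 then 1 else 0) (by
    intro F G h
    -- Reversing an orientation requires an inner vertex, so no relation touches the forest without
    -- vertices. This is what keeps its class nonzero.
    have hF : F.vertices.length ≠ 0 := by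
      cases h with
      | swap l₁ l₂ v w hF hG => simp [hF]
      | flip l₁ l₂ A B hF hG => simp [hF]
    rw [if_neg hF, if_neg (h.length_eq ▸ hF), add_zero])

theorem counit_cls (F : OrientedForest S) :
    counit S (cls F) = if F.vertices.length = 0 then 1 else 0 :=
  liftBess_cls _ _ F

theorem counit_noVertex (hS : S.Nonempty) : counit S (cls (.noVertex hS)) = 1 :=
  (counit_cls _).trans (if_pos rfl)

theorem counit_smul_noVertex (hS : S.Nonempty) {x : Bess S} (hx : x ∈ component S 0) :
    counit S x • cls (.noVertex hS) = x := by
  induction hx using Submodule.span_induction with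
  | mem x h =>
    obtain ⟨F, hF, rfl⟩ := h
    rw [OrientedForest.eq_noVertex hS hF, counit_noVertex, one_smul]
  | zero => simp
  | add x y _ _ hx hy => rw [map_add, add_smul, hx, hy]
  | smul c x _ hx => rw [map_smul, smul_assoc, hx]

theorem counit_of_mem {n : ℕ} (hn : n ≠ 0) {x : Bess S} (hx : x ∈ component S n) :
    counit S x = 0 := by
  induction hx using Submodule.span_induction with
  | mem x h =>
    obtain ⟨F, rfl, rfl⟩ := h
    rw [counit_cls, if_neg hn]
  | zero => simp
  | add x y _ _ hx hy => rw [map_add, hx, hy, add_zero]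
  | smul c x _ hx => rw [map_smul, hx, smul_zero]

/-- The identification of the component of degree zero with `ℚ`. -/
noncomputable def componentZeroEquiv (hS : S.Nonempty) : component S 0 ≃ₗ[ℚ] ℚ :=
  LinearEquiv.ofLinearMap (counit S ∘ₗ (component S 0).subtype)
    (LinearMap.toSpanSingleton ℚ _ (unitForest S hS))
    (LinearMap.ext_ring (by
      simp only [LinearMap.comp_apply, LinearMap.toSpanSingleton_apply, one_smul]
      exact counit_noVertex hS))
    (LinearMap.ext fun x => Subtype.ext (counit_smul_noVertex hS x.2))

theorem componentZeroEquiv_comp_proj (hS : S.Nonempty) :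
    (componentZeroEquiv hS).toLinearMap ∘ₗ proj S 0 = counit S := by
  refine hom_ext fun F => ?_
  have h : counit S (projEnd S 0 (cls F)) = counit S (cls F) := by
    rw [projEnd_cls]
    split_ifs with hF
    · rfl
    · rw [map_zero, counit_cls, if_neg hF]
  exact h

theorem refineCls_nil (hS : S.Nonempty) : refineCls S [] = cls (.noVertex hS) :=
  refineCls_vertices (.noVertex hS)

/-- The counit kills positive degrees, so only the splitting with empty left part survives, and its
sign is trivial. -/
theorem counit_rTensor_coproduct (S : Finset α) :
    (counit S).rTensor (Bess S) ∘ₗ coproduct S = TensorProduct.mk ℚ ℚ (Bess S) 1 := by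
  refine hom_ext fun F => ?_
  rw [LinearMap.comp_apply, coproduct_cls, listCoproduct, map_unshuffleSum, unshuffleSum_of_left]
  · rw [LinearMap.rTensor_tmul, refineCls_vertices, refineCls_nil F.isForest.nonempty,
      counit_noVertex, TensorProduct.mk_apply]
  · intro L R hL
    rw [LinearMap.rTensor_tmul, counit_of_mem (mt List.length_eq_zero_iff.1 hL)
      (refineCls_mem_component S L), TensorProduct.zero_tmul]

theorem counit_lTensor_coproduct (S : Finset α) :
    (counit S).lTensor (Bess S) ∘ₗ coproduct S = (TensorProduct.mk ℚ (Bess S) ℚ).flip 1 := by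
  refine hom_ext fun F => ?_
  rw [LinearMap.comp_apply, coproduct_cls, listCoproduct, map_unshuffleSum, unshuffleSum_of_right]
  · rw [LinearMap.lTensor_tmul, refineCls_vertices, refineCls_nil F.isForest.nonempty,
      counit_noVertex, LinearMap.flip_apply, TensorProduct.mk_apply]
  · intro L R hR
    rw [LinearMap.lTensor_tmul, counit_of_mem (mt List.length_eq_zero_iff.1 hR)
      (refineCls_mem_component S R), TensorProduct.tmul_zero]

end Coproduct

end Bessel

/-! ### Assembly of the main theorem -/

theorem mainTheorem7 {α : Type*} [DecidableEq α] :
    ∃ Δ : ∀ S : Finset α, Bessel.Bess S →ₗ[ℚ] Bessel.Bess S ⊗[ℚ] Bessel.Bess S,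
      Bessel.IsCoproduct Δ ∧ (∀ Δ₁, Bessel.IsCoproduct Δ₁ → Δ₁ = Δ) ∧
      ∀ (S : Finset α) (hS : S.Nonempty),
        Module.finrank ℚ (Bessel.component S 0) = 1 ∧
        ∃ e : Bessel.component S 0 ≃ₗ[ℚ] ℚ,
          e (Bessel.unitForest S hS) = 1 ∧
          ∃ (ε : Bessel.Bess S →ₗ[ℚ] ℚ) (η : ℚ →ₗ[ℚ] Bessel.Bess S),
            ε = e.toLinearMap ∘ₗ Bessel.proj S 0 ∧
            η = (Bessel.component S 0).subtype ∘ₗ e.symm.toLinearMap ∧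
            -- `ε` is a counit
            ε.rTensor (Bessel.Bess S) ∘ₗ Δ S = TensorProduct.mk ℚ ℚ (Bessel.Bess S) 1 ∧
            ε.lTensor (Bessel.Bess S) ∘ₗ Δ S = (TensorProduct.mk ℚ (Bessel.Bess S) ℚ).flip 1 ∧
            -- `η` is an augmentation: a morphism of coalgebras, compatible with the counits
            Δ S ∘ₗ η = TensorProduct.map η η ∘ₗ (CoalgebraStruct.comul : ℚ →ₗ[ℚ] ℚ ⊗[ℚ] ℚ) ∧
            ε ∘ₗ η = (CoalgebraStruct.counit : ℚ →ₗ[ℚ] ℚ) ∧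
            -- the forest with no inner vertex is grouplike
            Δ S (Bessel.unitForest S hS) =
              (Bessel.unitForest S hS : Bessel.Bess S) ⊗ₜ[ℚ]
                (Bessel.unitForest S hS : Bessel.Bess S) ∧
            ε (Bessel.unitForest S hS) = 1 := by
  refine ⟨Bessel.coproduct, Bessel.isCoproduct_coproduct,
    fun Δ₁ h => h.unique Bessel.isCoproduct_coproduct, fun S hS => ?_⟩
  -- The inverse of `componentZeroEquiv` is by construction `c ↦ c • unitForest S hS`.
  have hsymm : (Bessel.componentZeroEquiv hS).symm 1 = Bessel.unitForest S hS :=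
    one_smul ℚ (Bessel.unitForest S hS)
  have hunit : Bessel.componentZeroEquiv hS (Bessel.unitForest S hS) = 1 :=
    Bessel.counit_noVertex hS
  refine ⟨?_, Bessel.componentZeroEquiv hS, hunit, _, _, rfl, rfl, ?_⟩
  · rw [(Bessel.componentZeroEquiv hS).finrank_eq, Module.finrank_self]
  rw [Bessel.componentZeroEquiv_comp_proj]
  refine ⟨Bessel.counit_rTensor_coproduct S, Bessel.counit_lTensor_coproduct S, ?_, ?_,
    Bessel.coproduct_noVertex hS, Bessel.counit_noVertex hS⟩
  · refine LinearMap.ext_ring ?_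
    simp only [LinearMap.comp_apply, LinearEquiv.coe_coe, hsymm, CommSemiring.comul_apply,
      TensorProduct.map_tmul]
    exact Bessel.coproduct_noVertex hS
  · refine LinearMap.ext_ring ?_
    simp only [LinearMap.comp_apply, LinearEquiv.coe_coe, hsymm, CommSemiring.counit_apply]
    exact Bessel.counit_noVertex hS
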